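/- **Logic programs.** A rule is $r:\ a_1\vee\dots\vee a_n \leftarrow b_1,\dots,b_k,\ \mathrm{not}\ b_{k+1},\dots,\mathrm{not}\ b_m$ with classical literals $a_i,b_j$ (atoms $a$ or strongly negated atoms $\neg a$); $H(r)=\{a_1,\dots,a_n\}$, $B^+(r)=\{b_1,\dots,b_k\}$, $B^-(r)=\{b_{k+1},\dots,b_m\}$. For a ground program $P$ let $B_P$ be its Herbrand base (all literals over its predicate symbols and constants). A set of literals is consistent if it contains no complementary pair. An answer set of a $\mathrm{not}$-free ground program $P$ is a minimal consistent $X\subseteq B_P$ such that $B^+(r)\subseteq X$ implies $H(r)\cap X\ne\emptyset$ for all $r\in P$; $I\subseteq B_P$ is an answer set of a ground program $P$ if it is an answer set of $P^I$, obtained from $P$ by deleting each rule with $B^-(r)\cap I\neq\emptyset$ and the negative bodies of the others. $\mathcal{AS}(P)$ is the set of answer sets; for a function-free program with variables it is that of its ground instantiation over its Herbrand universe, where built-in comparisons $s<t$ (for a fixed total order on the constants) and $s\neq t$ have their fixed truth values. **Prioritized programs.** A propositional prioritized program is $\mathcal P=(P,<)$ with $P$ a finite set of propositional rules with exactly one head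 literal each and $<$ a strict partial order on $P$ ($r<r'$: $r$ has higher priority). A full prioritization of $\mathcal P$ is $(P,<')$ with $<'$ a strict total order on $P$ containing $<$; $\mathcal P$ is fully prioritized if it is its only full prioritization. A set $X$ of literals defeats $r$ if $X\cap B^-(r)\ne\emptyset$. For a fully prioritized $\mathcal P$ with rules $r_1<\dots<r_n$, all with $B^+(r_i)=\emptyset$, and a set $S$ of literals, let $S_0=\emptyset$; $S_i=S_{i-1}$ if $S_{i-1}$ defeats $r_i$, or if $H(r_i)\subseteq S$ and $S$ defeats $r_i$; and $S_i=S_{i-1}\cup H(r_i)$ otherwise. Put $C_{\mathcal P}(S)=S_n$ if $S_n$ is consistent, and $C_{\mathcal P}(S)=B_P$ otherwise. Such a $\mathcal P$ has $A$ as a B-preferred answer set iff $A\in\mathcal{AS}(P)$ and $C_{\mathcal P}(A)=A$. For an arbitrary fully prioritized $\mathcal P$, the dual reduct ${}^X\mathcal P$ is obtained by deleting the rules with $B^+(r)\not\subseteq X$ and the positive bodies of the other rules, the resulting rules being ordered by the first rule of $P$ (with respect to $<$) from which they result; $A$ is a B-preferred answer set of $\mathcal P$ iff $A\in\mathcal{AS}(P)$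 and $A$ is a B-preferred answer set of ${}^A\mathcal P$. If $\mathcal P$ is not fully prioritized, $A$ is a B-preferred answer set of $\mathcal P$ iff it is one of some full prioritization of $\mathcal P$. $\mathcal{BPAS}(\mathcal P)$ is the set of B-preferred answer sets of $\mathcal P$. **Representation.** Name the literals and the rules of $P$ by constants, different literals by different constants and different rules by different constants. $F(\mathcal P)$ consists of the facts $rule(r)$ for $r\in P$; $head(c,r)$ for $c\in H(r)$; $pbl(a,r)$ for $a\in B^+(r)$; $nbl(b,r)$ for $b\in B^-(r)$; $compl(a,\neg a)$ for each atom $a$ such that $a$ and $\neg a$ both occur in $P$; and $pr(r,r')$ for each pair $r<r'$ in the transitive reduction of $<$. **Meta-program.** $P_{I_B}$ consists of the rules 1. $in\_AS(X) \leftarrow head(X,R),\ pos\_body\_true(R),\ \mathrm{not}\ neg\_body\_false(R)$ 2. $pos\_body\_exists(R) \leftarrow pbl(X,R)$ 3. $pos\_body\_true(R) \leftarrow rule(R),\ \mathrm{not}\ pos\_body\_exists(R)$ 4. $pbl\_inbetween(X,Y,R) \leftarrow pbl(X,R),\ pbl(Y,R),\ pbl(Z,R),\ X<Z,\ Z<Y$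 5. $pbl\_notlast(X,R) \leftarrow pbl(X,R),\ pbl(Y,R),\ X<Y$ 6. $pbl\_notfirst(X,R) \leftarrow pbl(X,R),\ pbl(Y,R),\ Y<X$ 7. $pos\_body\_true\_upto(R,X) \leftarrow pbl(X,R),\ \mathrm{not}\ pbl\_notfirst(X,R),\ in\_AS(X)$ 8. $pos\_body\_true\_upto(R,X) \leftarrow pos\_body\_true\_upto(R,Y),\ pbl(X,R),\ in\_AS(X),\ Y<X,\ \mathrm{not}\ pbl\_inbetween(Y,X,R)$ 9. $pos\_body\_true(R) \leftarrow pos\_body\_true\_upto(R,X),\ \mathrm{not}\ pbl\_notlast(X,R)$ 10. $neg\_body\_false(Y) \leftarrow nbl(X,Y),\ in\_AS(X)$ 11. $\leftarrow compl(X,Y),\ in\_AS(X),\ in\_AS(Y)$ 12. $pr(X,Y)\vee pr(Y,X) \leftarrow rule(X),\ rule(Y),\ X\neq Y$ 13. $pr(X,Z) \leftarrow pr(X,Y),\ pr(Y,Z)$ 14. $\leftarrow pr(X,X)$ 15. $lit(X,Y) \leftarrow head(X,Y),\ pos\_body\_true(Y),\ \mathrm{not}\ defeat\_local(Y),\ \mathrm{not}\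 in\_AS(X)$ 16. $lit(X,Y) \leftarrow head(X,Y),\ pos\_body\_true(Y),\ \mathrm{not}\ defeat\_local(Y),\ \mathrm{not}\ defeat\_global(Y)$ 17. $defeat\_local(Y) \leftarrow nbl(X,Y),\ lit(X,Y_1),\ pr(Y_1,Y)$ 18. $defeat\_global(Y) \leftarrow nbl(X,Y),\ in\_AS(X)$ 19. $in\_CP(X) \leftarrow lit(X,Y)$ 20. $\leftarrow in\_CP(X),\ \mathrm{not}\ in\_AS(X)$ 21. $\leftarrow in\_AS(X),\ \mathrm{not}\ in\_CP(X)$ Let $\pi(A)=\{\ell \mid in\_AS(\ell)\in A\}$. **Theorem.** Let $\mathcal P=(P,<)$ be a propositional prioritized program. Then (i) if $A\in\mathcal{AS}(P_{I_B}\cup F(\mathcal P))$, then $\pi(A)\in\mathcal{BPAS}(\mathcal P)$; and (ii) for each $A\in\mathcal{BPAS}(\mathcal P)$ there exists some $A'\in\mathcal{AS}(P_{I_B}\cup F(\mathcal P))$ such that $\pi(A')=A$. -/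

import Mathlib

namespace ASP

/-! ## Literals and rules -/

/-- Classical literals over a set `At` of atoms: `a` and `¬ a`. -/
inductive Literal (At : Type*) where
  | pos (a : At) : Literal At
  | neg (a : At) : Literal At

namespace Literal

variable {At At' : Type*}

/-- The complementary literal. -/
def compl : Literal At → Literal At
  | pos a => neg a
  | neg a => pos a

/-- The atom of a literal. -/
def atom : Literal At → At
  | pos a => a
  | neg a => a

/-- Change of atoms, keeping the sign. -/
def map (f : At → At') : Literal At → Literal At'
  | pos a => pos (f a)
  | neg a => neg (f a)

end Literal

/-- A rule `a₁ v ⋯ v aₙ :- b₁, …, bₖ, not bₖ₊₁, …, not bₘ` over a set `L` of literals, with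
`head = [a₁, …, aₙ]`, `pos = [b₁, …, bₖ]` and `neg = [bₖ₊₁, …, bₘ]`.
An integrity constraint has `head = []`. -/
structure Rule (L : Type*) where
  head : List L
  pos : List L
  neg : List L

/-- The set of literals that occur in a rule. -/
def Rule.lits {L : Type*} (r : Rule L) : Set L := {l | l ∈ r.head ∨ l ∈ r.pos ∨ l ∈ r.neg}

/-! ## Answer sets of ground programs -/

section Ground

variable {At : Type*}

/-- A set of literals is consistent if it contains no two complementary literals. -/
def Consistent (I : Set (Literal At)) : Prop := I ∩ {l | l.compl ∈ I} = ∅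

/-- Closedness of a set of literals under a positive ground program (the condition on the rules). -/
def ClosedUnder (P : Set (Rule (Literal At))) (I : Set (Literal At)) : Prop :=
  ∀ r ∈ P, (∀ b ∈ r.pos, b ∈ I) → ∃ a ∈ r.head, a ∈ I

/-- The Gelfond–Lifschitz reduct of `P` with respect to `I`. -/
def glReduct (P : Set (Rule (Literal At))) (I : Set (Literal At)) : Set (Rule (Literal At)) :=
  {r' | ∃ r ∈ P, (∀ b ∈ r.neg, b ∉ I) ∧ r' = { r with neg := [] }}

/-- The answer sets of a positive ground program with Herbrand base `B`: the minimal consistent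
sets `X ⊆ B` that are closed under the program. -/
def positiveAnswerSets (B : Set (Literal At)) (P : Set (Rule (Literal At))) :
    Set (Set (Literal At)) :=
  {X | Minimal (fun I => I ⊆ B ∧ Consistent I ∧ ClosedUnder P I) X}

/-- The answer sets of an arbitrary ground program with Herbrand base `B`. -/
def groundAnswerSets (B : Set (Literal At)) (P : Set (Rule (Literal At))) :
    Set (Set (Literal At)) :=
  {I | I ∈ positiveAnswerSets B (glReduct P I)}

/-- The literals that occur in a propositional program. -/
def occurring (P : Set (Rule (Literal At))) : Set (Literal At) := {l | ∃ r ∈ P, l ∈ r.lits}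

/-- The Herbrand base of a propositional program: all literals over the atoms that occur in it. -/
def propBase (P : Set (Rule (Literal At))) : Set (Literal At) :=
  {l | l ∈ occurring P ∨ l.compl ∈ occurring P}

/-- The answer sets of a propositional program. -/
def propAnswerSets (P : Set (Rule (Literal At))) : Set (Set (Literal At)) :=
  groundAnswerSets (propBase P) P

end Ground

/-! ## Non-ground programs -/

/-- Function-free terms: variables and constants. -/
inductive Term (V C : Type*) where
  | var (v : V) : Term V C
  | const (c : C) : Term V C

/-- The value of a term under an assignment of constants to the variables. -/
def Term.subst {V C : Type*} (σ : V → C) : Term V C → C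
  | .var v => σ v
  | .const c => c

/-- An atom `p(t₁, …, tₙ)`; it is ground if the type `T` of its arguments is a type of constants. -/
structure Atom (Pr T : Type*) where
  pred : Pr
  args : List T

/-- Apply a map to all arguments of an atom. -/
def Atom.map {Pr T T' : Type*} (f : T → T') (a : Atom Pr T) : Atom Pr T' :=
  ⟨a.pred, a.args.map f⟩

/-- Built-in comparisons `s < t` and `s != t`. -/
inductive Cmp (T : Type*) where
  | lt (s t : T) : Cmp T
  | ne (s t : T) : Cmp T

/-- Truth of a comparison of terms under an assignment, for the built-in total order on the
constants. -/
def Cmp.Holds {V C : Type*} [LinearOrder C] (σ : V → C) : Cmp (Term V C) → Prop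
  | .lt s t => s.subst σ < t.subst σ
  | .ne s t => s.subst σ ≠ t.subst σ

/-- The set of terms in a comparison. -/
def Cmp.terms {T : Type*} : Cmp T → Set T
  | .lt s t => {s, t}
  | .ne s t => {s, t}

/-- A rule with variables whose body may also contain built-in comparisons. -/
structure FORule (Pr V C : Type*) extends Rule (Literal (Atom Pr (Term V C))) where
  cmp : List (Cmp (Term V C)) := []

section NonGround

variable {Pr V C : Type*}

/-- The ground literal obtained from a literal by substitution. -/
def substLit (σ : V → C) (l : Literal (Atom Pr (Term V C))) : Literal (Atom Pr C) :=
  l.map (Atom.map (Term.subst σ))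

/-- The ground rule obtained from a rule by substitution (comparisons are dropped). -/
def FORule.subst (σ : V → C) (r : FORule Pr V C) : Rule (Literal (Atom Pr C)) where
  head := r.head.map (substLit σ)
  pos := r.pos.map (substLit σ)
  neg := r.neg.map (substLit σ)

/-- The constants that occur in a program. -/
def constants (P : Set (FORule Pr V C)) : Set C :=
  {c | ∃ r ∈ P, (∃ l ∈ r.lits, Term.const c ∈ l.atom.args) ∨ (∃ b ∈ r.cmp, Term.const c ∈ b.terms)}

open Classical in
/-- The Herbrand universe: the constants that occur in the program, and an arbitrary constant if
there are none. -/
noncomputable def herbrandUniverse [Nonempty C] (P : Set (FORule Pr V C)) : Set C :=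
  if constants P = ∅ then {Classical.arbitrary C} else constants P

/-- The Herbrand base: all ground literals from predicate symbols in the program over the Herbrand
universe. A predicate symbol is a name together with a number of arguments. -/
def herbrandBase [Nonempty C] (P : Set (FORule Pr V C)) : Set (Literal (Atom Pr C)) :=
  {l | (∃ r ∈ P, ∃ k ∈ r.lits, l.atom.pred = k.atom.pred ∧
      l.atom.args.length = k.atom.args.length) ∧
    ∀ c ∈ l.atom.args, c ∈ herbrandUniverse P}

/-- The ground instantiation over the Herbrand universe. A built-in comparison has its fixed truth
value: the instances in which every comparison is true are kept, without the comparisons. -/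
def ground [Nonempty C] [LinearOrder C] (P : Set (FORule Pr V C)) :
    Set (Rule (Literal (Atom Pr C))) :=
  {r' | ∃ r ∈ P, ∃ σ : V → C, (∀ v, σ v ∈ herbrandUniverse P) ∧ (∀ b ∈ r.cmp, b.Holds σ) ∧
    r' = r.subst σ}

/-- The answer sets of a program with variables: those of its ground instantiation. -/
def answerSets [Nonempty C] [LinearOrder C] (P : Set (FORule Pr V C)) :
    Set (Set (Literal (Atom Pr C))) :=
  groundAnswerSets (herbrandBase P) (ground P)

end NonGround

/-! ## Prioritized programs and B-preferred answer sets -/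

/-- A prioritized propositional program: a finite set of normal rules (exactly one head literal)
with a strict partial order on this set; `lt r s` says that `r` has higher priority than `s`. -/
@[ext]
structure PrioritizedProgram (α : Type*) where
  rules : Set (Rule (Literal α))
  finite : rules.Finite
  normal : ∀ r ∈ rules, ∃ h, r.head = [h]
  lt : Rule (Literal α) → Rule (Literal α) → Prop
  lt_mem : ∀ r s, lt r s → r ∈ rules ∧ s ∈ rules
  lt_irrefl : ∀ r, ¬ lt r r
  lt_trans : ∀ r s t, lt r s → lt s t → lt r t

section Preferred

variable {α : Type*}

/-- The full prioritizations of `P`: the same rules with a total order that refines `P.lt`. -/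
def fullPrioritizations (P : PrioritizedProgram α) : Set (PrioritizedProgram α) :=
  {Q | Q.rules = P.rules ∧ (∀ r s, P.lt r s → Q.lt r s) ∧
    ∀ r ∈ Q.rules, ∀ s ∈ Q.rules, r ≠ s → Q.lt r s ∨ Q.lt s r}

/-- `P` is fully prioritized if it is its own only full prioritization. -/
def FullyPrioritized (P : PrioritizedProgram α) : Prop := fullPrioritizations P = {P}

/-- A set of literals defeats a rule if it meets the negative body of the rule. -/
def Defeats (X : Set (Literal α)) (r : Rule (Literal α)) : Prop := ∃ b ∈ r.neg, b ∈ X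

open Classical in
/-- One step `Sᵢ₋₁ ↦ Sᵢ`, for the rule `r = rᵢ`, of the sequence that defines `C_P(S)`. -/
noncomputable def cStep (S T : Set (Literal α)) (r : Rule (Literal α)) : Set (Literal α) :=
  if Defeats T r ∨ ((∀ h ∈ r.head, h ∈ S) ∧ Defeats S r) then T else T ∪ {h | h ∈ r.head}

/-- The last member `Sₙ` of the sequence `S₀ = ∅, S₁, …, Sₙ` for the rules `r₁, …, rₙ`. -/
noncomputable def cLast (rs : List (Rule (Literal α))) (S : Set (Literal α)) : Set (Literal α) :=
  rs.foldl (cStep S) ∅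

open Classical in
/-- `C_P(S)` for the fully prioritized prerequisite-free program with rules `r₁ < ⋯ < rₙ` and
Herbrand base `B`. -/
noncomputable def cOp (B : Set (Literal α)) (rs : List (Rule (Literal α)))
    (S : Set (Literal α)) : Set (Literal α) :=
  if Consistent (cLast rs S) then cLast rs S else B

/-- The list `rs` enumerates the rules of `P` in the order of `P`. -/
def Enumerates (P : PrioritizedProgram α) (rs : List (Rule (Literal α))) : Prop :=
  rs.Pairwise P.lt ∧ ∀ r, r ∈ rs ↔ r ∈ P.rules

/-- `A` is a B-preferred answer set of the fully prioritized prerequisite-free program `P`. -/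
def IsBPreferredPrereqFree (P : PrioritizedProgram α) (A : Set (Literal α)) : Prop :=
  A ∈ propAnswerSets P.rules ∧ ∃ rs, Enumerates P rs ∧ cOp (propBase P.rules) rs A = A

/-- Deletion of the positive body of a rule. -/
def dropPos (r : Rule (Literal α)) : Rule (Literal α) := { r with pos := [] }

/-- `r` is the first rule of `P` whose positive body is contained in `X` and which becomes `r'`
when its positive body is deleted. -/
def IsFirstOrigin (P : PrioritizedProgram α) (X : Set (Literal α))
    (r r' : Rule (Literal α)) : Prop :=
  (r ∈ P.rules ∧ (∀ b ∈ r.pos, b ∈ X) ∧ dropPos r = r') ∧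
    ∀ s, s ∈ P.rules → (∀ b ∈ s.pos, b ∈ X) → dropPos s = r' → s = r ∨ P.lt r s

theorem IsFirstOrigin.unique {P : PrioritizedProgram α} {X : Set (Literal α)}
    {r s r' : Rule (Literal α)} (hr : IsFirstOrigin P X r r') (hs : IsFirstOrigin P X s r') :
    r = s := by
  rcases hr.2 s hs.1.1 hs.1.2.1 hs.1.2.2 with h | h
  · exact h.symm
  · rcases hs.2 r hr.1.1 hr.1.2.1 hr.1.2.2 with h2 | h2
    · exact h2
    · exact absurd (P.lt_trans _ _ _ h h2) (P.lt_irrefl _)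

/-- The dual reduct of a fully prioritized program `P` with respect to `X`: rules whose positive
body is not contained in `X` are deleted, the positive bodies of the others are deleted, and a
resulting rule is ordered by the first rule of `P` from which it results. -/
def dualReduct (P : PrioritizedProgram α) (X : Set (Literal α)) : PrioritizedProgram α where
  rules := {r' | ∃ r ∈ P.rules, (∀ b ∈ r.pos, b ∈ X) ∧ dropPos r = r'}
  finite := (P.finite.image dropPos).subset (by
    rintro _ ⟨r, hr, -, rfl⟩
    exact ⟨r, hr, rfl⟩)
  normal := by
    rintro _ ⟨r, hr, -, rfl⟩
    exact P.normal r hr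
  lt := fun r' s' => ∃ r s, IsFirstOrigin P X r r' ∧ IsFirstOrigin P X s s' ∧ P.lt r s
  lt_mem := by
    rintro r' s' ⟨r, s, hr, hs, -⟩
    exact ⟨⟨r, hr.1⟩, ⟨s, hs.1⟩⟩
  lt_irrefl := by
    rintro r' ⟨r, s, hr, hs, h⟩
    rw [hr.unique hs] at h
    exact P.lt_irrefl _ h
  lt_trans := by
    rintro r' s' t' ⟨r, s, hr, hs, h⟩ ⟨s₂, t, hs₂, ht, h₂⟩
    rw [← hs.unique hs₂] at h₂
    exact ⟨r, t, hr, ht, P.lt_trans _ _ _ h h₂⟩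

/-- `A` is a B-preferred answer set of the fully prioritized program `P`. -/
def IsBPreferredFull (P : PrioritizedProgram α) (A : Set (Literal α)) : Prop :=
  A ∈ propAnswerSets P.rules ∧ IsBPreferredPrereqFree (dualReduct P A) A

open Classical in
/-- The set of B-preferred answer sets of a prioritized program. -/
def bpas (P : PrioritizedProgram α) : Set (Set (Literal α)) :=
  {A | A ∈ propAnswerSets P.rules ∧
    if FullyPrioritized P then IsBPreferredFull P A
    else ∃ Q ∈ fullPrioritizations P, IsBPreferredFull Q A}

end Preferred

/-! ## The meta-interpreter -/

/-- The predicate names of the meta-interpreter. -/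
inductive MetaPred where
  | rule | head | pbl | nbl | compl | pr
  | in_AS | pos_body_exists | pos_body_true | pos_body_true_upto
  | pbl_inbetween | pbl_notlast | pbl_notfirst | neg_body_false
  | lit | defeat_local | defeat_global | in_CP

/-- The variables of the meta-interpreter. -/
inductive MetaVar where
  | X | Y | Z | R | Y1

section Meta

variable {C : Type*}

/-- The literal `p(v₁, …, vₙ)` with variables as arguments. -/
def vAtom (p : MetaPred) (vs : List MetaVar) : Literal (Atom MetaPred (Term MetaVar C)) :=
  .pos ⟨p, vs.map .var⟩

/-- The comparison `u < v` of two variables. -/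
def vLt (u v : MetaVar) : Cmp (Term MetaVar C) := .lt (.var u) (.var v)

/-- The comparison `u != v` of two variables. -/
def vNe (u v : MetaVar) : Cmp (Term MetaVar C) := .ne (.var u) (.var v)

/-- The fact `p(c₁, …, cₙ).` -/
def fact (p : MetaPred) (cs : List C) : FORule MetaPred MetaVar C where
  head := [.pos ⟨p, cs.map .const⟩]
  pos := []
  neg := []

open MetaPred MetaVar

/-- The part of the meta-interpreter that represents an answer set. -/
def PIa : Set (FORule MetaPred MetaVar C) := {r | r ∈ ([
  { head := [vAtom in_AS [X]]
    pos := [vAtom MetaPred.head [X, R], vAtom pos_body_true [R]]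
    neg := [vAtom neg_body_false [R]] },
  { head := [vAtom pos_body_exists [R]]
    pos := [vAtom pbl [X, R]]
    neg := [] },
  { head := [vAtom pos_body_true [R]]
    pos := [vAtom rule [R]]
    neg := [vAtom pos_body_exists [R]] },
  { head := [vAtom pbl_inbetween [X, Y, R]]
    pos := [vAtom pbl [X, R], vAtom pbl [Y, R], vAtom pbl [Z, R]]
    neg := []
    cmp := [vLt X Z, vLt Z Y] },
  { head := [vAtom pbl_notlast [X, R]]
    pos := [vAtom pbl [X, R], vAtom pbl [Y, R]]
    neg := []
    cmp := [vLt X Y] },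
  { head := [vAtom pbl_notfirst [X, R]]
    pos := [vAtom pbl [X, R], vAtom pbl [Y, R]]
    neg := []
    cmp := [vLt Y X] },
  { head := [vAtom pos_body_true_upto [R, X]]
    pos := [vAtom pbl [X, R], vAtom in_AS [X]]
    neg := [vAtom pbl_notfirst [X, R]] },
  { head := [vAtom pos_body_true_upto [R, X]]
    pos := [vAtom pos_body_true_upto [R, Y], vAtom pbl [X, R], vAtom in_AS [X]]
    neg := [vAtom pbl_inbetween [Y, X, R]]
    cmp := [vLt Y X] },
  { head := [vAtom pos_body_true [R]]
    pos := [vAtom pos_body_true_upto [R, X]]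
    neg := [vAtom pbl_notlast [X, R]] },
  { head := [vAtom neg_body_false [Y]]
    pos := [vAtom nbl [X, Y], vAtom in_AS [X]]
    neg := [] },
  { head := []
    pos := [vAtom MetaPred.compl [X, Y], vAtom in_AS [X], vAtom in_AS [Y]]
    neg := [] }] : List (FORule MetaPred MetaVar C))}

/-- The meta-interpreter for B-preferred answer sets. -/
def PIB : Set (FORule MetaPred MetaVar C) := PIa ∪ {r | r ∈ ([
  { head := [vAtom pr [X, Y], vAtom pr [Y, X]]
    pos := [vAtom rule [X], vAtom rule [Y]]
    neg := []
    cmp := [vNe X Y] },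
  { head := [vAtom pr [X, Z]]
    pos := [vAtom pr [X, Y], vAtom pr [Y, Z]]
    neg := [] },
  { head := []
    pos := [vAtom pr [X, X]]
    neg := [] },
  { head := [vAtom lit [X, Y]]
    pos := [vAtom MetaPred.head [X, Y], vAtom pos_body_true [Y]]
    neg := [vAtom defeat_local [Y], vAtom in_AS [X]] },
  { head := [vAtom lit [X, Y]]
    pos := [vAtom MetaPred.head [X, Y], vAtom pos_body_true [Y]]
    neg := [vAtom defeat_local [Y], vAtom defeat_global [Y]] },
  { head := [vAtom defeat_local [Y]]
    pos := [vAtom nbl [X, Y], vAtom lit [X, Y1], vAtom pr [Y1, Y]]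
    neg := [] },
  { head := [vAtom defeat_global [Y]]
    pos := [vAtom nbl [X, Y], vAtom in_AS [X]]
    neg := [] },
  { head := [vAtom in_CP [X]]
    pos := [vAtom lit [X, Y]]
    neg := [] },
  { head := []
    pos := [vAtom in_CP [X]]
    neg := [vAtom in_AS [X]] },
  { head := []
    pos := [vAtom in_AS [X]]
    neg := [vAtom in_CP [X]] }] : List (FORule MetaPred MetaVar C))}

/-- The facts that represent a propositional program, where `nl` and `nr` give the constants that
name its literals and its rules. -/
def factsOfRules {α : Type*} (nl : Literal α → C) (nr : Rule (Literal α) → C)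
    (P : Set (Rule (Literal α))) : Set (FORule MetaPred MetaVar C) :=
  {f | ∃ r ∈ P, f = fact MetaPred.rule [nr r]} ∪
  {f | ∃ r ∈ P, ∃ c ∈ r.head, f = fact MetaPred.head [nl c, nr r]} ∪
  {f | ∃ r ∈ P, ∃ a ∈ r.pos, f = fact MetaPred.pbl [nl a, nr r]} ∪
  {f | ∃ r ∈ P, ∃ b ∈ r.neg, f = fact MetaPred.nbl [nl b, nr r]} ∪
  {f | ∃ a : α, Literal.pos a ∈ occurring P ∧ Literal.neg a ∈ occurring P ∧
    f = fact MetaPred.compl [nl (.pos a), nl (.neg a)]}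

/-- The facts that represent a prioritized program: those for its rules, and `pr(r, s)` for each
pair in the transitive reduction of its order. -/
def factsOf {α : Type*} (nl : Literal α → C) (nr : Rule (Literal α) → C)
    (P : PrioritizedProgram α) : Set (FORule MetaPred MetaVar C) :=
  factsOfRules nl nr P.rules ∪
  {f | ∃ r s, P.lt r s ∧ (¬ ∃ t, P.lt r t ∧ P.lt t s) ∧ f = fact MetaPred.pr [nr r, nr s]}

/-- The projection `π(A) = {ℓ | in_AS(ℓ) ∈ A}`. -/
def proj {α : Type*} (nl : Literal α → C) (A : Set (Literal (Atom MetaPred C))) :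
    Set (Literal α) :=
  {l | Literal.pos ⟨MetaPred.in_AS, [nl l]⟩ ∈ A}

end Meta

end ASP

/-! The priority condition has a form that needs neither the sequence for `C` nor the dual reduct.
Fix a total order and a set `X`. Call a rule applied if its positive body lies in `X`, no applied
rule of higher priority has its head in the negative body, and it is not the case that its head lies
in `X` while `X` defeats it. This recursion along the order is `IsApplied`, and
`isBPreferredFull_iff` shows that an answer set `X` is preferred iff the heads of the applied rules
form exactly `X`. Several rules may collapse to one in the dual reduct. This is harmless: if one of
them is applied, so is the first of them, which has the same head and negative body but fewer
predecessors. The meta-program states this recursion: `lit` records the applied rules, `pr` the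
total order, and the last two constraints equate `in_CP` with `in_AS`.

Soundness. Discarding the unsupported atoms of an answer set `A` leaves a set closed under the
reduct, so by minimality every atom of `A` is supported and each auxiliary predicate means what its
name says. The `pr` atoms form a strict total order on the rules; it extends the given order because
a finite strict order is generated by its covering pairs. The projection is an answer set because a
smaller closed set `J` of literals would let one thin out `A` to a smaller closed set
(`SupportedModel.metaClosed_restricted`).

Completeness. A preferred answer set and its full prioritization determine a canonical set of atoms.
It is closed, and any closed subset containing the facts rederives all of it. The disjunctive rule
for `pr` leaves no freedom inside this set, since a total relation contained in a strict total order
equals it.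

A literal and a rule may share a name: no argument position of a predicate holds both. -/

namespace ASP

/-! ### Closedness under the meta-program, one predicate at a time -/

section MetaModel

variable {α C : Type*}

/-- The atom `p(c₁, …, cₙ)` belongs to `M`. -/
def Has (M : Set (Literal (Atom MetaPred C))) (p : MetaPred) (cs : List C) : Prop :=
  Literal.pos ⟨p, cs⟩ ∈ M

/-- The set of the atoms that satisfy a specification. -/
def ofSpec (S : MetaPred → List C → Prop) : Set (Literal (Atom MetaPred C)) :=
  {l | match l with
    | .pos a => S a.pred a.args
    | .neg _ => False}

/-- A set of positive literals is consistent. -/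
theorem consistent_ofSpec (S : MetaPred → List C → Prop) : Consistent (ofSpec S) := by
  ext l
  cases l <;> simp [ofSpec, Literal.compl]

open MetaPred

/-- `M` contains the facts that represent `P`. -/
structure ContainsFacts (nl : Literal α → C) (nr : Rule (Literal α) → C)
    (P : PrioritizedProgram α) (M : Set (Literal (Atom MetaPred C))) : Prop where
  rule : ∀ r ∈ P.rules, Has M rule [nr r]
  head : ∀ r ∈ P.rules, ∀ c ∈ r.head, Has M head [nl c, nr r]
  pbl : ∀ r ∈ P.rules, ∀ c ∈ r.pos, Has M pbl [nl c, nr r]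
  nbl : ∀ r ∈ P.rules, ∀ c ∈ r.neg, Has M nbl [nl c, nr r]
  compl : ∀ a, Literal.pos a ∈ occurring P.rules → Literal.neg a ∈ occurring P.rules →
    Has M compl [nl (.pos a), nl (.neg a)]
  pr : ∀ r s, P.lt r s → (¬ ∃ t, P.lt r t ∧ P.lt t s) → Has M pr [nr r, nr s]

/-- `M` is closed under the reduct of the meta-interpreter with respect to `A`. -/
structure MetaClosed [LinearOrder C] (A M : Set (Literal (Atom MetaPred C))) : Prop where
  in_AS : ∀ x r, Has M head [x, r] → Has M pos_body_true [r] → ¬ Has A neg_body_false [r] →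
    Has M in_AS [x]
  pos_body_exists : ∀ x r, Has M pbl [x, r] → Has M pos_body_exists [r]
  pos_body_true : ∀ r, Has M rule [r] → ¬ Has A MetaPred.pos_body_exists [r] →
    Has M pos_body_true [r]
  pbl_inbetween : ∀ x y z r, Has M pbl [x, r] → Has M pbl [y, r] → Has M pbl [z, r] →
    x < z → z < y → Has M pbl_inbetween [x, y, r]
  pbl_notlast : ∀ x y r, Has M pbl [x, r] → Has M pbl [y, r] → x < y → Has M pbl_notlast [x, r]
  pbl_notfirst : ∀ x y r, Has M pbl [x, r] → Has M pbl [y, r] → y < x → Has M pbl_notfirst [x, r]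
  upto_first : ∀ x r, Has M pbl [x, r] → Has M MetaPred.in_AS [x] →
    ¬ Has A MetaPred.pbl_notfirst [x, r] → Has M pos_body_true_upto [r, x]
  upto_next : ∀ x y r, Has M pos_body_true_upto [r, y] → Has M pbl [x, r] →
    Has M MetaPred.in_AS [x] → y < x → ¬ Has A MetaPred.pbl_inbetween [y, x, r] →
    Has M pos_body_true_upto [r, x]
  pos_body_true_of_upto : ∀ x r, Has M pos_body_true_upto [r, x] →
    ¬ Has A MetaPred.pbl_notlast [x, r] → Has M MetaPred.pos_body_true [r]
  neg_body_false : ∀ x y, Has M nbl [x, y] → Has M MetaPred.in_AS [x] → Has M neg_body_false [y]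
  not_compl : ∀ x y, Has M compl [x, y] → Has M MetaPred.in_AS [x] → Has M MetaPred.in_AS [y] →
    False
  pr_total : ∀ x y, Has M rule [x] → Has M rule [y] → x ≠ y → Has M pr [x, y] ∨ Has M pr [y, x]
  pr_trans : ∀ x y z, Has M pr [x, y] → Has M pr [y, z] → Has M pr [x, z]
  pr_irrefl : ∀ x, Has M pr [x, x] → False
  lit_of_not_in_AS : ∀ x y, Has M head [x, y] → Has M MetaPred.pos_body_true [y] →
    ¬ Has A defeat_local [y] → ¬ Has A MetaPred.in_AS [x] → Has M lit [x, y]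
  lit_of_not_defeat : ∀ x y, Has M head [x, y] → Has M MetaPred.pos_body_true [y] →
    ¬ Has A defeat_local [y] → ¬ Has A defeat_global [y] → Has M lit [x, y]
  defeat_local : ∀ x y z, Has M nbl [x, y] → Has M lit [x, z] → Has M pr [z, y] →
    Has M defeat_local [y]
  defeat_global : ∀ x y, Has M nbl [x, y] → Has M MetaPred.in_AS [x] → Has M defeat_global [y]
  in_CP : ∀ x y, Has M lit [x, y] → Has M in_CP [x]
  in_AS_of_in_CP : ∀ x, Has M MetaPred.in_CP [x] → ¬ Has A MetaPred.in_AS [x] → False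
  in_CP_of_in_AS : ∀ x, Has M MetaPred.in_AS [x] → ¬ Has A MetaPred.in_CP [x] → False

theorem closedUnder_glReduct_ground {Pr V : Type*} [LinearOrder C] [Nonempty C]
    (R : Set (FORule Pr V C)) (A M : Set (Literal (Atom Pr C))) :
    ClosedUnder (glReduct (ground R) A) M ↔
      ∀ r ∈ R, ∀ σ : V → C, (∀ v, σ v ∈ herbrandUniverse R) → (∀ b ∈ r.cmp, b.Holds σ) →
        (∀ b ∈ r.neg, substLit σ b ∉ A) → (∀ b ∈ r.pos, substLit σ b ∈ M) →
        ∃ a ∈ r.head, substLit σ a ∈ M := by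
  constructor
  · intro h r hr σ hσ hc hn hp
    have := h { r.subst σ with neg := [] }
      ⟨r.subst σ, ⟨r, hr, σ, hσ, hc, rfl⟩, by simpa [FORule.subst] using hn, rfl⟩
      (by simpa [FORule.subst] using hp)
    simpa [FORule.subst] using this
  · rintro h _ ⟨_, ⟨r, hr, σ, hσ, hc, rfl⟩, hn, rfl⟩ hp
    have := h r hr σ hσ hc (by simpa [FORule.subst] using hn) (by simpa [FORule.subst] using hp)
    simpa [FORule.subst] using this

theorem substLit_vAtom (σ : MetaVar → C) (p : MetaPred) (vs : List MetaVar) :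
    substLit σ (vAtom p vs) = .pos ⟨p, vs.map σ⟩ := by
  simp [substLit, vAtom, Literal.map, Atom.map, Term.subst, Function.comp_def]

theorem substLit_const (σ : MetaVar → C) (p : MetaPred) (cs : List C) :
    substLit σ (.pos ⟨p, cs.map .const⟩) = .pos ⟨p, cs⟩ := by
  simp [substLit, Literal.map, Atom.map, Term.subst, Function.comp_def]

theorem herbrandUniverse_nonempty [Nonempty C] {Pr V : Type*} (R : Set (FORule Pr V C)) :
    (herbrandUniverse R).Nonempty := by
  unfold herbrandUniverse
  split_ifs with h
  · exact Set.singleton_nonempty _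
  · exact Set.nonempty_iff_ne_empty.2 h

section

variable [LinearOrder C] [Nonempty C] {nl : Literal α → C} {nr : Rule (Literal α) → C}
  {P : PrioritizedProgram α} {A M : Set (Literal (Atom MetaPred C))}

/-- Closedness under the reduct of the meta-interpreter with the facts for `P`. -/
theorem MetaClosed.closedUnder (h : MetaClosed A M) (hf : ContainsFacts nl nr P M) :
    ClosedUnder (glReduct (ground (PIB ∪ factsOf nl nr P)) A) M := by
  rw [closedUnder_glReduct_ground]
  rintro r ((hr | hr) | (((((hr | hr) | hr) | hr) | hr) | hr)) σ -
  · simp only [PIa, List.mem_cons, List.not_mem_nil, or_false, Set.mem_ofPred_eq] at hr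
    rcases hr with rfl | rfl | rfl | rfl | rfl | rfl | rfl | rfl | rfl | rfl | rfl <;>
      simp only [List.mem_cons, List.not_mem_nil, or_false, forall_eq_or_imp, forall_eq,
        substLit_vAtom, List.map, vLt, Cmp.Holds, Term.subst, exists_eq_left, IsEmpty.forall_iff,
        implies_true, forall_const, false_and, exists_false, imp_false]
    · exact fun a b => h.in_AS _ _ b.1 b.2 a
    · exact h.pos_body_exists _ _
    · exact fun a b => h.pos_body_true _ b a
    · exact fun a b => h.pbl_inbetween _ _ _ _ b.1 b.2.1 b.2.2 a.1 a.2
    · exact fun a b => h.pbl_notlast _ _ _ b.1 b.2 a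
    · exact fun a b => h.pbl_notfirst _ _ _ b.1 b.2 a
    · exact fun a b => h.upto_first _ _ b.1 b.2 a
    · exact fun a a' b => h.upto_next _ _ _ b.1 b.2.1 b.2.2 a a'
    · exact fun a b => h.pos_body_true_of_upto _ _ b a
    · exact fun b => h.neg_body_false _ _ b.1 b.2
    · exact fun b => h.not_compl _ _ b.1 b.2.1 b.2.2
  · simp only [List.mem_cons, List.not_mem_nil, or_false, Set.mem_ofPred_eq] at hr
    rcases hr with rfl | rfl | rfl | rfl | rfl | rfl | rfl | rfl | rfl | rfl <;>
      simp only [List.mem_cons, List.not_mem_nil, or_false, forall_eq_or_imp, forall_eq,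
        substLit_vAtom, List.map, vNe, Cmp.Holds, Term.subst, exists_eq_left, IsEmpty.forall_iff,
        implies_true, forall_const, false_and, exists_false, imp_false, exists_eq_or_imp]
    · exact fun a b => h.pr_total _ _ b.1 b.2 a
    · exact fun b => h.pr_trans _ _ _ b.1 b.2
    · exact h.pr_irrefl _
    · exact fun a b => h.lit_of_not_in_AS _ _ b.1 b.2 a.1 a.2
    · exact fun a b => h.lit_of_not_defeat _ _ b.1 b.2 a.1 a.2
    · exact fun b => h.defeat_local _ _ _ b.1 b.2.1 b.2.2
    · exact fun b => h.defeat_global _ _ b.1 b.2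
    · exact h.in_CP _ _
    · exact fun a b => h.in_AS_of_in_CP _ b a
    · exact fun a b => h.in_CP_of_in_AS _ b a
  all_goals intro _ _ _
  · obtain ⟨r, hr, rfl⟩ := hr
    exact ⟨_, List.mem_singleton_self _, by rw [substLit_const]; exact hf.rule r hr⟩
  · obtain ⟨r, hr, c, hc, rfl⟩ := hr
    exact ⟨_, List.mem_singleton_self _, by rw [substLit_const]; exact hf.head r hr c hc⟩
  · obtain ⟨r, hr, c, hc, rfl⟩ := hr
    exact ⟨_, List.mem_singleton_self _, by rw [substLit_const]; exact hf.pbl r hr c hc⟩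
  · obtain ⟨r, hr, c, hc, rfl⟩ := hr
    exact ⟨_, List.mem_singleton_self _, by rw [substLit_const]; exact hf.nbl r hr c hc⟩
  · obtain ⟨a, h1, h2, rfl⟩ := hr
    exact ⟨_, List.mem_singleton_self _, by rw [substLit_const]; exact hf.compl a h1 h2⟩
  · obtain ⟨r, s, h1, h2, rfl⟩ := hr
    exact ⟨_, List.mem_singleton_self _, by rw [substLit_const]; exact hf.pr r s h1 h2⟩

/-- The facts for `P` belong to every set that is closed under the meta-interpreter. -/
theorem ContainsFacts.of_closedUnder
    (h : ClosedUnder (glReduct (ground (PIB ∪ factsOf nl nr P)) A) M) :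
    ContainsFacts nl nr P M := by
  rw [closedUnder_glReduct_ground] at h
  obtain ⟨c, hc⟩ := herbrandUniverse_nonempty
    (PIB ∪ factsOf nl nr P : Set (FORule MetaPred MetaVar C))
  have key : ∀ p cs, fact p cs ∈ factsOf nl nr P → Has M p cs := fun p cs hp => by
    simpa [fact, substLit_const, Has] using h (fact p cs) (Or.inr hp) (fun _ => c) (fun _ => hc)
      (by simp [fact]) (by simp [fact]) (by simp [fact])
  constructor
  · exact fun r hr => key _ _ (.inl (.inl (.inl (.inl (.inl ⟨r, hr, rfl⟩)))))
  · exact fun r hr c hc => key _ _ (.inl (.inl (.inl (.inl (.inr ⟨r, hr, c, hc, rfl⟩)))))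
  · exact fun r hr c hc => key _ _ (.inl (.inl (.inl (.inr ⟨r, hr, c, hc, rfl⟩))))
  · exact fun r hr c hc => key _ _ (.inl (.inl (.inr ⟨r, hr, c, hc, rfl⟩)))
  · exact fun a h1 h2 => key _ _ (.inl (.inr ⟨a, h1, h2, rfl⟩))
  · exact fun r s h1 h2 => key _ _ (.inr ⟨r, s, h1, h2, rfl⟩)

/-- The assignment that maps the variables to the given constants. -/
def assign (x y z r y1 : C) : MetaVar → C
  | .X => x
  | .Y => y
  | .Z => z
  | .R => r
  | .Y1 => y1

/-- Closedness under the instances of a rule over `U`, in the reduct with respect to `A`. -/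
def InstanceClosed (U : Set C) (A M : Set (Literal (Atom MetaPred C)))
    (ru : FORule MetaPred MetaVar C) : Prop :=
  ∀ x ∈ U, ∀ y ∈ U, ∀ z ∈ U, ∀ r ∈ U, ∀ y1 ∈ U,
    (∀ b ∈ ru.cmp, b.Holds (assign x y z r y1)) →
    (∀ b ∈ ru.neg, substLit (assign x y z r y1) b ∉ A) →
    (∀ b ∈ ru.pos, substLit (assign x y z r y1) b ∈ M) →
    ∃ a ∈ ru.head, substLit (assign x y z r y1) a ∈ M

/-- `MetaClosed` quantifies over all constants, but the grounding has instances only over the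
Herbrand universe. The rules are safe: every variable of a rule occurs in its positive body, so the
bound on `M` places its value in the universe. -/
theorem MetaClosed.of_closedUnder
    (hM : M ⊆ herbrandBase (PIB ∪ factsOf nl nr P : Set (FORule MetaPred MetaVar C)))
    (h : ClosedUnder (glReduct (ground (PIB ∪ factsOf nl nr P)) A) M) :
    MetaClosed A M := by
  rw [closedUnder_glReduct_ground] at h
  set U := herbrandUniverse (PIB ∪ factsOf nl nr P : Set (FORule MetaPred MetaVar C))
  -- `d` is a dummy value for the variables that do not occur in the rule at hand.
  obtain ⟨d, hd⟩ : U.Nonempty := herbrandUniverse_nonempty _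
  have hU : ∀ {p : MetaPred} {c : C} {cs : List C}, Has M p (c :: cs) → c ∈ U := fun hp =>
    (hM hp).2 _ (List.mem_cons_self ..)
  have hU2 : ∀ {p : MetaPred} {b c : C} {cs : List C}, Has M p (b :: c :: cs) → c ∈ U := fun hp =>
    (hM hp).2 _ (List.mem_cons_of_mem _ (List.mem_cons_self ..))
  have key : ∀ ru ∈ (PIB : Set (FORule MetaPred MetaVar C)), InstanceClosed U A M ru :=
    fun ru hru x hx y hy z hz r hr y1 hy1 =>
      h ru (Or.inl hru) _ (by rintro (_ | _ | _ | _ | _) <;> assumption)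
  simp only [PIB, PIa, Set.mem_union, Set.mem_ofPred_eq, or_imp, forall_and, List.mem_cons,
    List.not_mem_nil, or_false, forall_eq] at key
  obtain ⟨⟨k1, k2, k3, k4, k5, k6, k7, k8, k9, k10, k11⟩, k12, k13, k14, k15, k16, k17, k18, k19,
    k20, k21⟩ := key
  simp only [InstanceClosed, List.mem_cons,
    List.not_mem_nil, or_false, forall_eq_or_imp, forall_eq, substLit_vAtom, List.map, vLt, vNe,
    Cmp.Holds, Term.subst, exists_eq_left, IsEmpty.forall_iff, implies_true, forall_const,
    false_and, exists_false, imp_false, exists_eq_or_imp, assign]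
    at k1 k2 k3 k4 k5 k6 k7 k8 k9 k10 k11 k12 k13 k14 k15 k16 k17 k18 k19 k20 k21
  constructor
  · exact fun x r h1 h2 h3 => k1 x (hU h1) d hd d hd r (hU h2) d hd h3 ⟨h1, h2⟩
  · exact fun x r h1 => k2 x (hU h1) d hd d hd r (hU2 h1) d hd h1
  · exact fun r h1 h2 => k3 d hd d hd d hd r (hU h1) d hd h2 h1
  · exact fun x y z r h1 h2 h3 h4 h5 =>
      k4 x (hU h1) y (hU h2) z (hU h3) r (hU2 h1) d hd ⟨h4, h5⟩ ⟨h1, h2, h3⟩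
  · exact fun x y r h1 h2 h3 => k5 x (hU h1) y (hU h2) d hd r (hU2 h1) d hd h3 ⟨h1, h2⟩
  · exact fun x y r h1 h2 h3 => k6 x (hU h1) y (hU h2) d hd r (hU2 h1) d hd h3 ⟨h1, h2⟩
  · exact fun x r h1 h2 h3 => k7 x (hU h1) d hd d hd r (hU2 h1) d hd h3 ⟨h1, h2⟩
  · exact fun x y r h1 h2 h3 h4 h5 =>
      k8 x (hU h2) y (hU2 h1) d hd r (hU h1) d hd h4 h5 ⟨h1, h2, h3⟩
  · exact fun x r h1 h2 => k9 x (hU2 h1) d hd d hd r (hU h1) d hd h2 h1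
  · exact fun x y h1 h2 => k10 x (hU h1) y (hU2 h1) d hd d hd d hd ⟨h1, h2⟩
  · exact fun x y h1 h2 h3 => k11 x (hU h2) y (hU h3) d hd d hd d hd ⟨h1, h2, h3⟩
  · exact fun x y h1 h2 h3 => k12 x (hU h1) y (hU h2) d hd d hd d hd h3 ⟨h1, h2⟩
  · exact fun x y z h1 h2 => k13 x (hU h1) y (hU h2) z (hU2 h2) d hd d hd ⟨h1, h2⟩
  · exact fun x h1 => k14 x (hU h1) d hd d hd d hd d hd h1
  · exact fun x y h1 h2 h3 h4 => k15 x (hU h1) y (hU h2) d hd d hd d hd ⟨h3, h4⟩ ⟨h1, h2⟩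
  · exact fun x y h1 h2 h3 h4 => k16 x (hU h1) y (hU h2) d hd d hd d hd ⟨h3, h4⟩ ⟨h1, h2⟩
  · exact fun x y z h1 h2 h3 => k17 x (hU h1) y (hU2 h1) d hd d hd z (hU h3) ⟨h1, h2, h3⟩
  · exact fun x y h1 h2 => k18 x (hU h1) y (hU2 h1) d hd d hd d hd ⟨h1, h2⟩
  · exact fun x y h1 => k19 x (hU h1) y (hU2 h1) d hd d hd d hd h1
  · exact fun x h1 h2 => k20 x (hU h1) d hd d hd d hd d hd h2 h1
  · exact fun x h1 h2 => k21 x (hU h1) d hd d hd d hd d hd h2 h1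

/-- The answer sets of the meta-interpreter in terms of closedness. -/
theorem mem_answerSets_iff :
    A ∈ answerSets (PIB ∪ factsOf nl nr P) ↔
      (A ⊆ herbrandBase (PIB ∪ factsOf nl nr P : Set (FORule MetaPred MetaVar C)) ∧
        Consistent A ∧ MetaClosed A A ∧ ContainsFacts nl nr P A) ∧
      ∀ M ⊆ A, MetaClosed A M → ContainsFacts nl nr P M → M = A := by
  constructor
  · rintro ⟨⟨hB, hc, hA⟩, hmin⟩
    -- Consistency and inclusion in the Herbrand base pass to subsets, so competitors of `A` need
    -- only closedness and the facts.
    refine ⟨⟨hB, hc, .of_closedUnder hB hA, .of_closedUnder hA⟩, fun M hMA hM hf => ?_⟩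
    refine subset_antisymm hMA (hmin ⟨hMA.trans hB, ?_, hM.closedUnder hf⟩ hMA)
    refine Set.eq_empty_of_subset_empty fun l hl => ?_
    exact hc.subset ⟨hMA hl.1, hMA hl.2⟩
  · rintro ⟨⟨hB, hc, hA, hf⟩, hmin⟩
    refine ⟨⟨hB, hc, hA.closedUnder hf⟩, fun M ⟨hMB, _, hM⟩ hMA => ?_⟩
    exact (hmin M hMA (.of_closedUnder hMB hM) (.of_closedUnder hM)).ge

end

end MetaModel

/-! ### Answer sets of normal programs and of their dual reducts -/

section Normal

variable {α : Type*}

/-- A rule fires in `X` if its positive body is contained in `X`, which does not defeat it. -/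
def Fires (X : Set (Literal α)) (r : Rule (Literal α)) : Prop :=
  (∀ b ∈ r.pos, b ∈ X) ∧ ¬ Defeats X r

theorem closedUnder_glReduct_iff {R : Set (Rule (Literal α))} {X J : Set (Literal α)} :
    ClosedUnder (glReduct R X) J ↔
      ∀ r ∈ R, ¬ Defeats X r → (∀ b ∈ r.pos, b ∈ J) → ∃ a ∈ r.head, a ∈ J := by
  constructor
  · intro h r hr hd hp
    exact h { r with neg := [] } ⟨r, hr, fun b hb hX => hd ⟨b, hb, hX⟩, rfl⟩ hp
  · rintro h _ ⟨r, hr, hn, rfl⟩ hp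
    exact h r hr (fun ⟨b, hb, hX⟩ => hn b hb hX) hp

theorem Consistent.mono {At : Type*} {X Y : Set (Literal At)} (h : Consistent Y) (hXY : X ⊆ Y) :
    Consistent X :=
  Set.eq_empty_of_subset_empty fun _ hl => h.subset ⟨hXY hl.1, hXY hl.2⟩

/-- The answer sets of a propositional program. -/
theorem mem_propAnswerSets_iff {R : Set (Rule (Literal α))} {X : Set (Literal α)} :
    X ∈ propAnswerSets R ↔
      (X ⊆ propBase R ∧ Consistent X ∧ ClosedUnder (glReduct R X) X) ∧
      ∀ J ⊆ X, ClosedUnder (glReduct R X) J → J = X := by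
  constructor
  · rintro ⟨⟨hB, hc, hX⟩, hmin⟩
    exact ⟨⟨hB, hc, hX⟩, fun J hJX hJ => subset_antisymm hJX
      (hmin ⟨hJX.trans hB, hc.mono hJX, hJ⟩ hJX)⟩
  · rintro ⟨⟨hB, hc, hX⟩, hmin⟩
    exact ⟨⟨hB, hc, hX⟩, fun J ⟨_, _, hJ⟩ hJX => (hmin J hJX hJ).ge⟩

/-- Each literal of an answer set is in the head of a rule that fires. -/
theorem exists_fires_of_mem {R : Set (Rule (Literal α))} {X : Set (Literal α)}
    (hX : X ∈ propAnswerSets R) {l : Literal α} (hl : l ∈ X) :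
    ∃ r ∈ R, l ∈ r.head ∧ Fires X r := by
  obtain ⟨⟨-, -, hcl⟩, hmin⟩ := mem_propAnswerSets_iff.1 hX
  rw [closedUnder_glReduct_iff] at hcl
  -- The literals of `X` derived by a firing rule already form a closed set, so minimality leaves no
  -- others.
  have := hmin {l ∈ X | ∃ r ∈ R, l ∈ r.head ∧ Fires X r} (fun _ h => h.1)
    (closedUnder_glReduct_iff.2 fun r hr hd hp => by
      have hp' : ∀ b ∈ r.pos, b ∈ X := fun b hb => (hp b hb).1
      obtain ⟨a, ha, haX⟩ := hcl r hr hd hp'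
      exact ⟨a, ha, haX, r, hr, ha, hp', hd⟩)
  rw [← this] at hl
  exact hl.2

variable {P : PrioritizedProgram α} {X : Set (Literal α)}

theorem PrioritizedProgram.head_mem_of_fires (P : PrioritizedProgram α)
    (hX : X ∈ propAnswerSets P.rules) {r : Rule (Literal α)} (hr : r ∈ P.rules)
    (hf : Fires X r) {l : Literal α} (hl : l ∈ r.head) : l ∈ X := by
  obtain ⟨a, ha, haX⟩ :=
    closedUnder_glReduct_iff.1 (mem_propAnswerSets_iff.1 hX).1.2.2 r hr hf.2 hf.1
  obtain ⟨h, hh⟩ := P.normal r hr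
  simp only [hh, List.mem_singleton] at ha hl
  rwa [hl, ← ha]

theorem compl_compl (l : Literal α) : l.compl.compl = l := by cases l <;> rfl

/-- An answer set of a program is an answer set of its dual reduct. -/
theorem mem_propAnswerSets_dualReduct (hX : X ∈ propAnswerSets P.rules) :
    X ∈ propAnswerSets (dualReduct P X).rules := by
  rw [mem_propAnswerSets_iff]
  refine ⟨⟨fun l hl => ?_, (mem_propAnswerSets_iff.1 hX).1.2.1, closedUnder_glReduct_iff.2 ?_⟩,
    fun J hJX hJ => subset_antisymm hJX fun l hl => ?_⟩
  · obtain ⟨r, hr, hlr, hf⟩ := exists_fires_of_mem hX hl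
    exact Or.inl ⟨dropPos r, ⟨r, hr, hf.1, rfl⟩, Or.inl hlr⟩
  · rintro _ ⟨r, hr, hp, rfl⟩ hd -
    exact closedUnder_glReduct_iff.1 (mem_propAnswerSets_iff.1 hX).1.2.2 r hr hd hp
  -- Minimality: each literal of `X` is the head of a firing rule, whose image in the dual reduct
  -- has an empty body, so `J` must contain that head.
  · obtain ⟨r, hr, hlr, hf⟩ := exists_fires_of_mem hX hl
    obtain ⟨a, ha, haJ⟩ := closedUnder_glReduct_iff.1 hJ (dropPos r) ⟨r, hr, hf.1, rfl⟩ hf.2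
      (by simp [dropPos])
    obtain ⟨h, hh⟩ := P.normal r hr
    simp only [dropPos, hh, List.mem_singleton] at ha hlr
    rwa [hlr, ← ha]

theorem mem_cLast {rs : List (Rule (Literal α))} {S : Set (Literal α)} {l : Literal α}
    (hl : l ∈ cLast rs S) : ∃ r ∈ rs, l ∈ r.head := by
  suffices ∀ T, l ∈ rs.foldl (cStep S) T → l ∈ T ∨ ∃ r ∈ rs, l ∈ r.head by
    simpa using this ∅ hl
  clear hl
  induction rs with
  | nil => exact fun T h => Or.inl h
  | cons r rs ih =>
    intro T h
    rcases ih _ h with h | ⟨s, hs, h⟩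
    · unfold cStep at h
      split_ifs at h
      · exact Or.inl h
      · rcases h with h | h
        · exact Or.inl h
        · exact Or.inr ⟨r, List.mem_cons_self .., h⟩
    · exact Or.inr ⟨s, List.mem_cons_of_mem _ hs, h⟩

/-- For consistent sets, the operator `C_P` may be replaced by the last member of its sequence. -/
theorem cOp_eq_iff {R : Set (Rule (Literal α))} {rs : List (Rule (Literal α))}
    (hrs : ∀ r ∈ rs, r ∈ R) (hX : Consistent X) :
    cOp (propBase R) rs X = X ↔ cLast rs X = X := by
  unfold cOp
  split_ifs with h
  · rfl
  · constructor <;> intro h2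
    -- The fallback value never equals `X`: an inconsistent last member contains some head `l`, and
    -- the Herbrand base then contains both `l` and its complement, whereas `X` is consistent.
    · refine absurd (Set.eq_empty_of_subset_empty fun l hl => ?_) h
      obtain ⟨r, hr, hlr⟩ := mem_cLast hl.1
      have hl1 : l ∈ propBase R := Or.inl ⟨r, hrs r hr, Or.inl hlr⟩
      have hl2 : l.compl ∈ propBase R := Or.inr (by
        rw [compl_compl]; exact ⟨r, hrs r hr, Or.inl hlr⟩)
      rw [h2] at hl1 hl2
      exact hX.subset ⟨hl1, hl2⟩
    · rw [h2] at h
      exact absurd hX h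

/-! ### Applied rules and the operator `C` -/

/-- `Ap` is the set of the rules that are applied in the computation of `C(X)`. -/
def IsApplied (P : PrioritizedProgram α) (X : Set (Literal α))
    (Ap : Rule (Literal α) → Prop) : Prop :=
  ∀ r ∈ P.rules, Ap r ↔ (∀ b ∈ r.pos, b ∈ X) ∧
    (¬ ∃ s, Ap s ∧ P.lt s r ∧ ∃ b ∈ r.neg, b ∈ s.head) ∧
    ¬ ((∀ h ∈ r.head, h ∈ X) ∧ Defeats X r)

theorem PrioritizedProgram.wellFounded (P : PrioritizedProgram α) : WellFounded P.lt := by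
  have : Finite P.rules := P.finite
  have : IsStrictOrder P.rules (fun r s => P.lt r s) :=
    { irrefl := fun r => P.lt_irrefl r, trans := fun r s t => P.lt_trans r s t }
  have hwf : WellFounded (fun r s : P.rules => P.lt r s) :=
    Finite.wellFounded_of_trans_of_irrefl _
  -- Accessibility is needed at every rule, but all predecessors lie in the finite set `P.rules`.
  refine ⟨fun r => ⟨r, fun s hs => ?_⟩⟩
  suffices ∀ s : P.rules, Acc P.lt s from this ⟨s, (P.lt_mem _ _ hs).1⟩
  intro s
  induction s using hwf.induction with
  | _ s ih => exact ⟨_, fun t ht => ih ⟨t, (P.lt_mem _ _ ht).1⟩ ht⟩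

/-- Whether a rule is applied depends only on rules of higher priority, so well-founded recursion
along `P.lt` defines the predicate. -/
theorem exists_isApplied (P : PrioritizedProgram α) (X : Set (Literal α)) :
    ∃ Ap, IsApplied P X Ap := by
  refine ⟨P.wellFounded.fix fun r ih => (∀ b ∈ r.pos, b ∈ X) ∧
    (¬ ∃ s, ∃ h : P.lt s r, ih s h ∧ ∃ b ∈ r.neg, b ∈ s.head) ∧
    ¬ ((∀ h ∈ r.head, h ∈ X) ∧ Defeats X r), fun r _ => ?_⟩
  rw [WellFounded.fix_eq]
  refine and_congr_right' (and_congr_left' (not_congr (exists_congr fun s => ?_)))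
  exact ⟨fun ⟨h1, h2, h3⟩ => ⟨h2, h1, h3⟩, fun ⟨h2, h1, h3⟩ => ⟨h1, h2, h3⟩⟩

/-- The order of `P` is total on its rules. -/
def PrioritizedProgram.IsTotal (P : PrioritizedProgram α) : Prop :=
  ∀ r ∈ P.rules, ∀ s ∈ P.rules, r ≠ s → P.lt r s ∨ P.lt s r

theorem exists_isFirstOrigin (hP : P.IsTotal) {r' : Rule (Literal α)}
    (hr' : r' ∈ (dualReduct P X).rules) : ∃ r, IsFirstOrigin P X r r' := by
  obtain ⟨r, hr, hmin⟩ := P.wellFounded.has_min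
    {r | r ∈ P.rules ∧ (∀ b ∈ r.pos, b ∈ X) ∧ dropPos r = r'} hr'
  refine ⟨r, hr, fun s h1 h2 h3 => ?_⟩
  by_contra! h
  rcases hP _ h1 _ hr.1 h.1 with h4 | h4
  · exact hmin s ⟨h1, h2, h3⟩ h4
  · exact h.2 h4

theorem dualReduct_isTotal (hP : P.IsTotal) : (dualReduct P X).IsTotal := by
  intro r' hr' s' hs' hne
  obtain ⟨r, hr⟩ := exists_isFirstOrigin hP hr'
  obtain ⟨s, hs⟩ := exists_isFirstOrigin hP hs'
  have : r ≠ s := by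
    rintro rfl
    exact hne (hr.1.2.2.symm.trans hs.1.2.2)
  exact (hP _ hr.1.1 _ hs.1.1 this).imp (fun h => ⟨r, s, hr, hs, h⟩) fun h => ⟨s, r, hs, hr, h⟩

/-- The rules of a totally ordered program can be enumerated. -/
theorem exists_enumerates (hP : P.IsTotal) : ∃ rs, Enumerates P rs := by
  -- Generalized to finite subsets, so that a minimal rule can be split off and the rest enumerated
  -- by induction.
  suffices ∀ F : Finset (Rule (Literal α)), (F : Set (Rule (Literal α))) ⊆ P.rules →
      ∃ rs : List (Rule (Literal α)), rs.Pairwise P.lt ∧ ∀ r, r ∈ rs ↔ r ∈ F by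
    obtain ⟨rs, h1, h2⟩ := this P.finite.toFinset (by simp)
    exact ⟨rs, h1, by simpa using h2⟩
  classical
  intro F
  induction F using Finset.strongInduction with
  | _ F ih =>
    intro hF
    rcases F.eq_empty_or_nonempty with rfl | hne
    · exact ⟨[], by simp⟩
    obtain ⟨r, hr, hmin⟩ := P.wellFounded.has_min (F : Set (Rule (Literal α))) hne
    obtain ⟨rs, h1, h2⟩ := ih (F.erase r) (Finset.erase_ssubset hr)
      (fun s hs => hF (Finset.mem_of_mem_erase hs))
    refine ⟨r :: rs, List.pairwise_cons.2 ⟨fun s hs => ?_, h1⟩, fun s => ?_⟩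
    · obtain ⟨hsr, hs⟩ := Finset.mem_erase.1 ((h2 s).1 hs)
      exact (hP _ (hF hr) _ (hF hs) hsr.symm).resolve_right (hmin s hs)
    · by_cases h : s = r
      · simpa [h] using hr
      · simp [h, h2]

/-- Rules with the same image have the same head and negative body, and every predecessor of the
first origin `s` also precedes `r`. Hence anything that blocks `s` blocks `r`, and the first origin
can stand for all rules that collapse with it. -/
theorem IsApplied.of_lt {Ap : Rule (Literal α) → Prop} (hAp : IsApplied P X Ap)
    {r s r' : Rule (Literal α)} (hs : IsFirstOrigin P X s r') (hr : r ∈ P.rules)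
    (hrr' : dropPos r = r') (h : Ap r) : Ap s := by
  obtain ⟨hp, hloc, hgl⟩ := (hAp r hr).1 h
  rcases hs.2 r hr hp hrr' with rfl | hlt
  · exact h
  · have hd : dropPos r = dropPos s := hrr'.trans hs.1.2.2.symm
    have hhead : r.head = s.head := (congrArg Rule.head hd :)
    have hneg : r.neg = s.neg := (congrArg Rule.neg hd :)
    refine (hAp s hs.1.1).2 ⟨hs.1.2.1, fun ⟨t, ht, hts, h⟩ => hloc ⟨t, ht, ?_, ?_⟩, ?_⟩
    · exact P.lt_trans _ _ _ hts hlt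
    · rwa [hneg]
    · simpa only [Defeats, hhead, hneg] using hgl

/-- The sequence that defines `C(X)` for the dual reduct collects the heads of the applied rules. -/
theorem foldl_cStep_eq {Ap : Rule (Literal α) → Prop} (hP : P.IsTotal) (hAp : IsApplied P X Ap)
    (l₂ l₁ : List (Rule (Literal α))) (hrs : Enumerates (dualReduct P X) (l₁ ++ l₂)) :
    l₂.foldl (cStep X) {h | ∃ r ∈ P.rules, Ap r ∧ dropPos r ∈ l₁ ∧ h ∈ r.head} =
      {h | ∃ r ∈ P.rules, Ap r ∧ h ∈ r.head} := by
  induction l₂ generalizing l₁ with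
  | nil =>
    rw [List.append_nil] at hrs
    ext h
    refine ⟨fun ⟨r, hr, ha, _, hh⟩ => ⟨r, hr, ha, hh⟩, fun ⟨r, hr, ha, hh⟩ =>
      ⟨r, hr, ha, (hrs.2 _).2 ⟨r, hr, ((hAp r hr).1 ha).1, rfl⟩, hh⟩⟩
  | cons r' l₂ ih =>
    have hrs' : Enumerates (dualReduct P X) ((l₁ ++ [r']) ++ l₂) := by simpa using hrs
    rw [List.foldl_cons, ← ih _ hrs']
    congr 1
    obtain ⟨r, hr⟩ := exists_isFirstOrigin hP ((hrs.2 r').1 (by simp))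
    have hpw := List.pairwise_append.1 hrs.1
    have hhead : r'.head = r.head := by rw [← hr.1.2.2]; rfl
    have hneg : r'.neg = r.neg := by rw [← hr.1.2.2]; rfl
    -- Defeat by the heads collected over the prefix `l₁` is defeat by an applied rule of higher
    -- priority than the first origin `r`.
    have hloc : Defeats {h | ∃ s ∈ P.rules, Ap s ∧ dropPos s ∈ l₁ ∧ h ∈ s.head} r' ↔
        ∃ s, Ap s ∧ P.lt s r ∧ ∃ b ∈ r.neg, b ∈ s.head := by
      unfold Defeats
      rw [hneg]
      constructor
      · rintro ⟨b, hb, s, hs, has, hsl, hbs⟩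
        -- `s` itself may come after `r`; its first origin `s₀` comes before `r`, has the same head
        -- and is applied too.
        obtain ⟨s₀, r₀, hs₀, hr₀, hlt⟩ := hpw.2.2 _ hsl r' (by simp)
        rw [hr₀.unique hr] at hlt
        refine ⟨s₀, hAp.of_lt hs₀ hs rfl has, hlt, b, hb, ?_⟩
        rwa [show s₀.head = s.head from (congrArg Rule.head hs₀.1.2.2 :)]
      · rintro ⟨s, has, hlt, b, hb, hbs⟩
        have hs := (P.lt_mem _ _ hlt).1
        have hsd : dropPos s ∈ (dualReduct P X).rules := ⟨s, hs, ((hAp s hs).1 has).1, rfl⟩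
        refine ⟨b, hb, s, hs, has, ?_, hbs⟩
        obtain ⟨s₀, hs₀⟩ := exists_isFirstOrigin hP hsd
        have hlt' : P.lt s₀ r := by
          rcases hs₀.2 s hs ((hAp s hs).1 has).1 rfl with h | h
          · rwa [← h]
          · exact P.lt_trans _ _ _ h hlt
        have hlt₂ : (dualReduct P X).lt (dropPos s) r' := ⟨s₀, r, hs₀, hr, hlt'⟩
        -- The image of `s` precedes `r'` in the enumeration, so it is neither `r'` nor a member of
        -- `l₂`.
        rcases List.mem_append.1 ((hrs.2 _).2 hsd) with h | h
        · exact h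
        · rcases List.mem_cons.1 h with h | h
          · rw [h] at hlt₂
            exact absurd hlt₂ ((dualReduct P X).lt_irrefl _)
          · have := (List.pairwise_cons.1 hpw.2.1).1 _ h
            exact absurd ((dualReduct P X).lt_trans _ _ _ this hlt₂)
              ((dualReduct P X).lt_irrefl _)
    -- The step for `r'` adds its head exactly when the first origin `r` is applied.
    have happ : Ap r ↔ ¬ (Defeats {h | ∃ s ∈ P.rules, Ap s ∧ dropPos s ∈ l₁ ∧ h ∈ s.head} r' ∨
        ((∀ h ∈ r'.head, h ∈ X) ∧ Defeats X r')) := by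
      rw [hAp r hr.1.1, hloc, not_or]
      simp only [Defeats, hhead, hneg]
      exact and_iff_right hr.1.2.1
    unfold cStep
    split_ifs with h
    · ext a
      constructor
      · rintro ⟨s, hs, has, hsl, hh⟩
        exact ⟨s, hs, has, by simp [hsl], hh⟩
      · rintro ⟨s, hs, has, hsl, hh⟩
        rcases List.mem_append.1 hsl with hsl | hsl
        · exact ⟨s, hs, has, hsl, hh⟩
        -- A skipped `r'` has no applied origin at all, since any such origin would make `r`
        -- applied.
        · exact absurd h (happ.1 (hAp.of_lt hr hs (List.mem_singleton.1 hsl) has))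
    · ext a
      constructor
      · rintro (⟨s, hs, has, hsl, hh⟩ | hh)
        · exact ⟨s, hs, has, by simp [hsl], hh⟩
        · exact ⟨r, hr.1.1, happ.2 h, by simp [hr.1.2.2], hhead ▸ hh⟩
      · rintro ⟨s, hs, has, hsl, hh⟩
        rcases List.mem_append.1 hsl with hsl | hsl
        · exact Or.inl ⟨s, hs, has, hsl, hh⟩
        · refine Or.inr ?_
          rw [← List.mem_singleton.1 hsl]
          exact hh

/-- The B-preferred answer sets of a totally ordered program consist of the heads of the rules that
are applied. -/
theorem isBPreferredFull_iff {Ap : Rule (Literal α) → Prop} (hP : P.IsTotal)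
    (hAp : IsApplied P X Ap) :
    IsBPreferredFull P X ↔
      X ∈ propAnswerSets P.rules ∧ {h | ∃ r ∈ P.rules, Ap r ∧ h ∈ r.head} = X := by
  refine and_congr_right fun hX => ?_
  have hc := (mem_propAnswerSets_iff.1 hX).1.2.1
  have key : ∀ rs, Enumerates (dualReduct P X) rs →
      (cOp (propBase (dualReduct P X).rules) rs X = X ↔
        {h | ∃ r ∈ P.rules, Ap r ∧ h ∈ r.head} = X) := fun rs hrs => by
    rw [cOp_eq_iff (fun r hr => (hrs.2 r).1 hr) hc, cLast, ← foldl_cStep_eq hP hAp rs [] hrs]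
    simp
  constructor
  · rintro ⟨-, rs, hrs, h⟩
    exact (key rs hrs).1 h
  · intro h
    obtain ⟨rs, hrs⟩ := exists_enumerates (dualReduct_isTotal (X := X) hP)
    exact ⟨mem_propAnswerSets_dualReduct hX, rs, hrs, (key rs hrs).2 h⟩

/-- The B-preferred answer sets are those of the full prioritizations. -/
theorem mem_bpas_iff :
    X ∈ bpas P ↔ ∃ Q ∈ fullPrioritizations P, IsBPreferredFull Q X := by
  unfold bpas
  simp only [Set.mem_ofPred_eq]
  split_ifs with h
  · rw [h]
    simp only [Set.mem_singleton_iff, exists_eq_left, and_iff_right_iff_imp]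
    exact fun h => h.1
  · simp only [and_iff_right_iff_imp]
    rintro ⟨Q, hQ, h⟩
    rw [← hQ.1]
    exact h.1

/-- A transitive relation that contains the covering pairs of the order of `P` contains the order. -/
theorem PrioritizedProgram.lt_le_of_covers (P : PrioritizedProgram α)
    {T : Rule (Literal α) → Rule (Literal α) → Prop}
    (hcov : ∀ r s, P.lt r s → (¬ ∃ t, P.lt r t ∧ P.lt t s) → T r s)
    (htrans : ∀ r s t, T r s → T s t → T r t) {r s : Rule (Literal α)} (h : P.lt r s) : T r s := by
  have hfin : ∀ r s, {t | P.lt r t ∧ P.lt t s}.Finite := fun r s =>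
    P.finite.subset fun t ht => (P.lt_mem _ _ ht.1).2
  -- Induction on the number of rules strictly between `r` and `s`: an intermediate `t` splits the
  -- interval into two smaller ones.
  induction hn : {t | P.lt r t ∧ P.lt t s}.ncard using Nat.strong_induction_on generalizing r s with
  | _ n ih =>
    by_cases hc : ∃ t, P.lt r t ∧ P.lt t s
    · obtain ⟨t, h1, h2⟩ := hc
      subst hn
      refine htrans r t s (ih _ ?_ h1 rfl) (ih _ ?_ h2 rfl)
      · refine Set.ncard_lt_ncard ⟨fun u hu => ⟨hu.1, P.lt_trans _ _ _ hu.2 h2⟩, fun hsub => ?_⟩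
          (hfin _ _)
        exact P.lt_irrefl t (hsub ⟨h1, h2⟩).2
      · refine Set.ncard_lt_ncard ⟨fun u hu => ⟨P.lt_trans _ _ _ h1 hu.1, hu.2⟩, fun hsub => ?_⟩
          (hfin _ _)
        exact P.lt_irrefl t (hsub ⟨h1, h2⟩).1
    · exact hcov r s h hc

end Normal

/-! ### Soundness: from answer sets of the meta-program to preferred answer sets -/

section Soundness

variable {α C : Type*} [LinearOrder C] {nl : Literal α → C} {nr : Rule (Literal α) → C}
  {P : PrioritizedProgram α} {A M : Set (Literal (Atom MetaPred C))}

open MetaPred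

/-- The atoms of `A` about the order of the positive bodies are true. -/
structure BodyOrderSound (nl : Literal α → C) (nr : Rule (Literal α) → C)
    (P : PrioritizedProgram α) (A : Set (Literal (Atom MetaPred C))) : Prop where
  exists_mem : ∀ r ∈ P.rules, Has A pos_body_exists [nr r] → ∃ b, b ∈ r.pos
  inbetween : ∀ r ∈ P.rules, ∀ x y, Has A pbl_inbetween [x, y, nr r] →
    ∃ b ∈ r.pos, x < nl b ∧ nl b < y
  notlast : ∀ r ∈ P.rules, ∀ x, Has A pbl_notlast [x, nr r] → ∃ b ∈ r.pos, x < nl b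
  notfirst : ∀ r ∈ P.rules, ∀ x, Has A pbl_notfirst [x, nr r] → ∃ b ∈ r.pos, nl b < x

theorem finite_image_list {β γ : Type*} (f : β → γ) (l : List β) : {c | ∃ b ∈ l, f b = c}.Finite :=
  (List.finite_toSet l).image f

/-- If the part of the positive body of a rule up to `nl b` holds in `M`, then the iteration along
the body reaches `nl b`. -/
theorem MetaClosed.has_pos_body_true_upto (hM : MetaClosed A M) (hf : ContainsFacts nl nr P M)
    (hA : BodyOrderSound nl nr P A) {r : Rule (Literal α)} (hr : r ∈ P.rules) {b : Literal α}
    (hb : b ∈ r.pos) (h : ∀ b' ∈ r.pos, nl b' ≤ nl b → Has M MetaPred.in_AS [nl b']) :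
    Has M pos_body_true_upto [nr r, nl b] := by
  have hfin := finite_image_list nl r.pos
  suffices ∀ c ∈ {c | ∃ b ∈ r.pos, nl b = c}, c ≤ nl b → Has M pos_body_true_upto [nr r, c] from
    this _ ⟨b, hb, rfl⟩ le_rfl
  intro c hc
  -- The order on the constants need not be well-founded, but its restriction to the finitely many
  -- names of body literals is.
  refine Set.WellFoundedOn.induction (r := (· < ·)) hfin.wellFoundedOn hc
    (P := fun c => c ≤ nl b → Has M pos_body_true_upto [nr r, c]) ?_
  rintro _ ⟨d, hd, rfl⟩ ih hdb
  by_cases hfst : Has A MetaPred.pbl_notfirst [nl d, nr r]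
  · obtain ⟨d', hd', hlt'⟩ := hA.notfirst r hr _ hfst
    -- `y` is the immediate predecessor of `d` in the body: its name is the greatest body name below
    -- `nl d`.
    obtain ⟨_, ⟨⟨y, hy, rfl⟩, hlt⟩, hmax⟩ := Set.exists_max_image
      {c | (∃ b ∈ r.pos, nl b = c) ∧ c < nl d} id (hfin.subset fun _ h => h.1)
      ⟨nl d', ⟨d', hd', rfl⟩, hlt'⟩
    refine hM.upto_next _ _ _ (ih _ ⟨y, hy, rfl⟩ hlt (hlt.le.trans hdb)) (hf.pbl r hr d hd)
      (h d hd hdb) hlt fun hbt => ?_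
    obtain ⟨z, hz, hyz, hzd⟩ := hA.inbetween r hr _ _ hbt
    exact absurd (hmax _ ⟨⟨z, hz, rfl⟩, hzd⟩) (not_le.2 hyz)
  · exact hM.upto_first _ _ (hf.pbl r hr d hd) (h d hd hdb) hfst

/-- If the positive body of a rule holds in `M`, then the iteration along it reaches its end. -/
theorem MetaClosed.has_pos_body_true (hM : MetaClosed A M) (hf : ContainsFacts nl nr P M)
    (hA : BodyOrderSound nl nr P A) {r : Rule (Literal α)} (hr : r ∈ P.rules)
    (h : ∀ b ∈ r.pos, Has M MetaPred.in_AS [nl b]) : Has M MetaPred.pos_body_true [nr r] := by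
  rcases Set.eq_empty_or_nonempty {c | ∃ b ∈ r.pos, nl b = c} with he | hne
  · refine hM.pos_body_true _ (hf.rule r hr) fun hex => ?_
    obtain ⟨b, hb⟩ := hA.exists_mem r hr hex
    exact he.subset ⟨b, hb, rfl⟩
  obtain ⟨_, ⟨b, hb, rfl⟩, hmax⟩ := Set.exists_max_image _ id (finite_image_list nl r.pos) hne
  refine hM.pos_body_true_of_upto _ _
    (hM.has_pos_body_true_upto hf hA hr hb fun b' hb' _ => h b' hb') fun hl => ?_
  obtain ⟨d, hd, hlt⟩ := hA.notlast r hr _ hl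
  exact absurd (hmax _ ⟨d, hd, rfl⟩) (not_le.2 hlt)

/-- The condition that some rule of the meta-program with the atom in its head has a body that is
true in `A`; for `pr`, only that the arguments are rules. -/
def Supported (nl : Literal α → C) (nr : Rule (Literal α) → C) (P : PrioritizedProgram α)
    (A : Set (Literal (Atom MetaPred C))) : MetaPred → List C → Prop
  | rule, [a] => ∃ r ∈ P.rules, nr r = a
  | head, [x, a] => ∃ r ∈ P.rules, ∃ c ∈ r.head, nl c = x ∧ nr r = a
  | pbl, [x, a] => ∃ r ∈ P.rules, ∃ c ∈ r.pos, nl c = x ∧ nr r = a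
  | nbl, [x, a] => ∃ r ∈ P.rules, ∃ c ∈ r.neg, nl c = x ∧ nr r = a
  | pr, [x, y] => (∃ r ∈ P.rules, nr r = x) ∧ ∃ r ∈ P.rules, nr r = y
  | in_AS, [x] => ∃ r, Has A head [x, r] ∧ Has A pos_body_true [r] ∧ ¬ Has A neg_body_false [r]
  | pos_body_exists, [r] => ∃ x, Has A pbl [x, r]
  | pos_body_true, [r] => (Has A rule [r] ∧ ¬ Has A pos_body_exists [r]) ∨
      ∃ x, Has A pos_body_true_upto [r, x] ∧ ¬ Has A pbl_notlast [x, r]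
  | pbl_inbetween, [x, y, r] => ∃ z, Has A pbl [z, r] ∧ x < z ∧ z < y
  | pbl_notlast, [x, r] => ∃ z, Has A pbl [z, r] ∧ x < z
  | pbl_notfirst, [x, r] => ∃ z, Has A pbl [z, r] ∧ z < x
  | pos_body_true_upto, [r, x] => Has A pbl [x, r] ∧ Has A in_AS [x] ∧
      (¬ Has A pbl_notfirst [x, r] ∨
        ∃ y, Has A pos_body_true_upto [r, y] ∧ y < x ∧ ¬ Has A pbl_inbetween [y, x, r])
  | neg_body_false, [y] => ∃ x, Has A nbl [x, y] ∧ Has A in_AS [x]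
  | lit, [x, y] => Has A head [x, y] ∧ Has A pos_body_true [y] ∧ ¬ Has A defeat_local [y] ∧
      (¬ Has A in_AS [x] ∨ ¬ Has A defeat_global [y])
  | defeat_local, [y] => ∃ x z, Has A nbl [x, y] ∧ Has A lit [x, z] ∧ Has A pr [z, y]
  | defeat_global, [y] => ∃ x, Has A nbl [x, y] ∧ Has A in_AS [x]
  | in_CP, [x] => ∃ y, Has A lit [x, y]
  | _, _ => True

/-- A rule whose body holds in the smaller set supports its own head, and constraints survive
passage to a subset. With minimality of `A`, this gives support for every atom of `A`. -/
theorem metaClosed_supported (hA : MetaClosed A A) :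
    MetaClosed A (A ∩ ofSpec (Supported nl nr P A)) where
  in_AS x r h1 h2 h3 := ⟨hA.in_AS x r h1.1 h2.1 h3, r, h1.1, h2.1, h3⟩
  pos_body_exists x r h1 := ⟨hA.pos_body_exists x r h1.1, x, h1.1⟩
  pos_body_true r h1 h2 := ⟨hA.pos_body_true r h1.1 h2, Or.inl ⟨h1.1, h2⟩⟩
  pbl_inbetween x y z r h1 h2 h3 h4 h5 :=
    ⟨hA.pbl_inbetween x y z r h1.1 h2.1 h3.1 h4 h5, z, h3.1, h4, h5⟩
  pbl_notlast x y r h1 h2 h3 := ⟨hA.pbl_notlast x y r h1.1 h2.1 h3, y, h2.1, h3⟩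
  pbl_notfirst x y r h1 h2 h3 := ⟨hA.pbl_notfirst x y r h1.1 h2.1 h3, y, h2.1, h3⟩
  upto_first x r h1 h2 h3 := ⟨hA.upto_first x r h1.1 h2.1 h3, h1.1, h2.1, Or.inl h3⟩
  upto_next x y r h1 h2 h3 h4 h5 :=
    ⟨hA.upto_next x y r h1.1 h2.1 h3.1 h4 h5, h2.1, h3.1, Or.inr ⟨y, h1.1, h4, h5⟩⟩
  pos_body_true_of_upto x r h1 h2 :=
    ⟨hA.pos_body_true_of_upto x r h1.1 h2, Or.inr ⟨x, h1.1, h2⟩⟩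
  neg_body_false x y h1 h2 := ⟨hA.neg_body_false x y h1.1 h2.1, x, h1.1, h2.1⟩
  not_compl x y h1 h2 h3 := hA.not_compl x y h1.1 h2.1 h3.1
  pr_total x y h1 h2 h3 := (hA.pr_total x y h1.1 h2.1 h3).imp
    (fun h => ⟨h, h1.2, h2.2⟩) fun h => ⟨h, h2.2, h1.2⟩
  pr_trans x y z h1 h2 := ⟨hA.pr_trans x y z h1.1 h2.1, h1.2.1, h2.2.2⟩
  pr_irrefl x h1 := hA.pr_irrefl x h1.1
  lit_of_not_in_AS x y h1 h2 h3 h4 :=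
    ⟨hA.lit_of_not_in_AS x y h1.1 h2.1 h3 h4, h1.1, h2.1, h3, Or.inl h4⟩
  lit_of_not_defeat x y h1 h2 h3 h4 :=
    ⟨hA.lit_of_not_defeat x y h1.1 h2.1 h3 h4, h1.1, h2.1, h3, Or.inr h4⟩
  defeat_local x y z h1 h2 h3 :=
    ⟨hA.defeat_local x y z h1.1 h2.1 h3.1, x, z, h1.1, h2.1, h3.1⟩
  defeat_global x y h1 h2 := ⟨hA.defeat_global x y h1.1 h2.1, x, h1.1, h2.1⟩
  in_CP x y h1 := ⟨hA.in_CP x y h1.1, y, h1.1⟩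
  in_AS_of_in_CP x h1 h2 := hA.in_AS_of_in_CP x h1.1 h2
  in_CP_of_in_AS x h1 h2 := hA.in_CP_of_in_AS x h1.1 h2

theorem containsFacts_supported (hf : ContainsFacts nl nr P A) :
    ContainsFacts nl nr P (A ∩ ofSpec (Supported nl nr P A)) where
  rule r hr := ⟨hf.rule r hr, r, hr, rfl⟩
  head r hr c hc := ⟨hf.head r hr c hc, r, hr, c, hc, rfl, rfl⟩
  pbl r hr c hc := ⟨hf.pbl r hr c hc, r, hr, c, hc, rfl, rfl⟩
  nbl r hr c hc := ⟨hf.nbl r hr c hc, r, hr, c, hc, rfl, rfl⟩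
  compl a h1 h2 := ⟨hf.compl a h1 h2, trivial⟩
  pr r s h1 h2 := ⟨hf.pr r s h1 h2, ⟨r, (P.lt_mem _ _ h1).1, rfl⟩, s, (P.lt_mem _ _ h1).2, rfl⟩

/-- `A` is closed under the meta-program for `P`, and each of its atoms is supported. -/
structure SupportedModel (nl : Literal α → C) (nr : Rule (Literal α) → C)
    (P : PrioritizedProgram α) (A : Set (Literal (Atom MetaPred C))) : Prop where
  closed : MetaClosed A A
  facts : ContainsFacts nl nr P A
  supported : ∀ {p cs}, Has A p cs → Supported nl nr P A p cs
  injective : Function.Injective nl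
  injOn : Set.InjOn nr P.rules

theorem SupportedModel.pbl_iff (h : SupportedModel nl nr P A) {r : Rule (Literal α)}
    (hr : r ∈ P.rules) {x : C} : Has A pbl [x, nr r] ↔ ∃ b ∈ r.pos, nl b = x := by
  constructor
  · intro hx
    obtain ⟨s, hs, c, hc, rfl, hsr⟩ := h.supported hx
    exact ⟨c, h.injOn hs hr hsr ▸ hc, rfl⟩
  · rintro ⟨b, hb, rfl⟩
    exact h.facts.pbl r hr b hb

theorem SupportedModel.nbl_iff (h : SupportedModel nl nr P A) {r : Rule (Literal α)}
    (hr : r ∈ P.rules) {x : C} : Has A nbl [x, nr r] ↔ ∃ b ∈ r.neg, nl b = x := by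
  constructor
  · intro hx
    obtain ⟨s, hs, c, hc, rfl, hsr⟩ := h.supported hx
    exact ⟨c, h.injOn hs hr hsr ▸ hc, rfl⟩
  · rintro ⟨b, hb, rfl⟩
    exact h.facts.nbl r hr b hb

theorem SupportedModel.head_iff (h : SupportedModel nl nr P A) {r : Rule (Literal α)}
    (hr : r ∈ P.rules) {l : Literal α} : Has A head [nl l, nr r] ↔ l ∈ r.head := by
  constructor
  · intro hx
    obtain ⟨s, hs, c, hc, hcl, hsr⟩ := h.supported hx
    exact h.injective hcl ▸ h.injOn hs hr hsr ▸ hc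
  · exact h.facts.head r hr l

theorem SupportedModel.bodyOrderSound (h : SupportedModel nl nr P A) :
    BodyOrderSound nl nr P A where
  exists_mem r hr hx := by
    obtain ⟨x, hx⟩ := h.supported hx
    obtain ⟨b, hb, -⟩ := (h.pbl_iff hr).1 hx
    exact ⟨b, hb⟩
  inbetween r hr x y hx := by
    obtain ⟨z, hz, h1⟩ := h.supported hx
    obtain ⟨b, hb, rfl⟩ := (h.pbl_iff hr).1 hz
    exact ⟨b, hb, h1⟩
  notlast r hr x hx := by
    obtain ⟨z, hz, h1⟩ := h.supported hx
    obtain ⟨b, hb, rfl⟩ := (h.pbl_iff hr).1 hz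
    exact ⟨b, hb, h1⟩
  notfirst r hr x hx := by
    obtain ⟨z, hz, h1⟩ := h.supported hx
    obtain ⟨b, hb, rfl⟩ := (h.pbl_iff hr).1 hz
    exact ⟨b, hb, h1⟩

/-- A supported `pos_body_true_upto` atom starts at the first body name or comes from an earlier one
with no body name between. Descending along these steps meets every body literal, so the iteration
cannot skip a false one. -/
theorem SupportedModel.pos_body_true_iff (h : SupportedModel nl nr P A) {r : Rule (Literal α)}
    (hr : r ∈ P.rules) : Has A pos_body_true [nr r] ↔ ∀ b ∈ r.pos, b ∈ proj nl A := by
  refine ⟨fun hp b hb => ?_, h.closed.has_pos_body_true h.facts h.bodyOrderSound hr⟩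
  rcases h.supported hp with ⟨-, h1⟩ | ⟨x, hx, hl⟩
  · exact absurd (h.closed.pos_body_exists _ _ (h.facts.pbl r hr b hb)) h1
  have hdown : ∀ c ∈ {c | ∃ b ∈ r.pos, nl b = c}, Has A pos_body_true_upto [nr r, c] →
      ∀ b ∈ r.pos, nl b ≤ c → Has A in_AS [nl b] := by
    intro c hc
    refine Set.WellFoundedOn.induction (r := (· < ·)) (finite_image_list nl r.pos).wellFoundedOn hc
      (P := fun c => Has A pos_body_true_upto [nr r, c] →
        ∀ b ∈ r.pos, nl b ≤ c → Has A in_AS [nl b]) ?_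
    rintro _ ⟨c, hc, rfl⟩ ih hup b hb hbc
    obtain ⟨-, hin, hcase⟩ := h.supported hup
    rcases hbc.eq_or_lt with heq | hlt
    · rwa [heq]
    rcases hcase with hfst | ⟨y, hy, hyc, hbt⟩
    · exact absurd (h.closed.pbl_notfirst _ _ _ (h.facts.pbl r hr c hc) (h.facts.pbl r hr b hb)
        hlt) hfst
    · have hys := (h.supported hy).1
      refine ih y ((h.pbl_iff hr).1 hys) hyc hy b hb (not_lt.1 fun hyb => hbt ?_)
      exact h.closed.pbl_inbetween _ _ _ _ hys (h.facts.pbl r hr c hc) (h.facts.pbl r hr b hb)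
        hyb hlt
  have hxs := (h.supported hx).1
  refine hdown x ((h.pbl_iff hr).1 hxs) hx b hb (not_lt.1 fun hlt => hl ?_)
  exact h.closed.pbl_notlast _ _ _ hxs (h.facts.pbl r hr b hb) hlt

theorem SupportedModel.neg_body_false_iff (h : SupportedModel nl nr P A) {r : Rule (Literal α)}
    (hr : r ∈ P.rules) : Has A neg_body_false [nr r] ↔ Defeats (proj nl A) r := by
  constructor
  · intro hn
    obtain ⟨x, hx, hin⟩ := h.supported hn
    obtain ⟨b, hb, rfl⟩ := (h.nbl_iff hr).1 hx
    exact ⟨b, hb, hin⟩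
  · rintro ⟨b, hb, hin⟩
    exact h.closed.neg_body_false _ _ (h.facts.nbl r hr b hb) hin

theorem SupportedModel.defeat_global_iff (h : SupportedModel nl nr P A) {r : Rule (Literal α)}
    (hr : r ∈ P.rules) : Has A defeat_global [nr r] ↔ Defeats (proj nl A) r := by
  constructor
  · intro hn
    obtain ⟨x, hx, hin⟩ := h.supported hn
    obtain ⟨b, hb, rfl⟩ := (h.nbl_iff hr).1 hx
    exact ⟨b, hb, hin⟩
  · rintro ⟨b, hb, hin⟩
    exact h.closed.defeat_global _ _ (h.facts.nbl r hr b hb) hin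

theorem SupportedModel.exists_head (h : SupportedModel nl nr P A) {l : Literal α}
    (hl : l ∈ proj nl A) : ∃ r ∈ P.rules, l ∈ r.head ∧ Fires (proj nl A) r := by
  obtain ⟨a, h1, h2, h3⟩ := h.supported hl
  obtain ⟨r, hr, c, hc, hcl, rfl⟩ := h.supported h1
  exact ⟨r, hr, h.injective hcl ▸ hc, (h.pos_body_true_iff hr).1 h2,
    fun hd => h3 ((h.neg_body_false_iff hr).2 hd)⟩

/-- The restriction to a set `J` of literals of the part that derives an answer set. -/
def Restricted (nl : Literal α → C) (nr : Rule (Literal α) → C) (P : PrioritizedProgram α)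
    (J : Set (Literal α)) : MetaPred → List C → Prop
  | in_AS, [c] => ∀ l, nl l = c → l ∈ J
  | pos_body_true, [a] => ∀ r ∈ P.rules, nr r = a → ∀ b ∈ r.pos, b ∈ J
  | pos_body_true_upto, [a, c] => ∀ r ∈ P.rules, nr r = a → ∀ b ∈ r.pos, nl b ≤ c → b ∈ J
  | _, _ => True

/-- Only `in_AS`, `pos_body_true` and `pos_body_true_upto` are thinned out. All other heads remain
available from `A`, and bodies in the smaller set also hold in `A`. For the thinned predicates,
closedness of `J` handles `in_AS`, and the order of the body handles the iteration. -/
theorem SupportedModel.metaClosed_restricted (h : SupportedModel nl nr P A) {J : Set (Literal α)}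
    (hJ : ClosedUnder (glReduct P.rules (proj nl A)) J) :
    MetaClosed A (A ∩ ofSpec (Restricted nl nr P J)) where
  in_AS x a h1 h2 h3 := by
    refine ⟨h.closed.in_AS x a h1.1 h2.1 h3, ?_⟩
    rintro l rfl
    obtain ⟨r, hr, c, hc, hcl, rfl⟩ := h.supported h1.1
    obtain ⟨c', hc', hcJ⟩ := closedUnder_glReduct_iff.1 hJ r hr
      (fun hd => h3 ((h.neg_body_false_iff hr).2 hd)) (h2.2 r hr rfl)
    obtain ⟨d, hd⟩ := P.normal r hr
    simp only [hd, List.mem_singleton] at hc hc'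
    rwa [← h.injective hcl, hc, ← hc']
  pos_body_exists x r h1 := ⟨h.closed.pos_body_exists x r h1.1, trivial⟩
  pos_body_true a h1 h2 := by
    refine ⟨h.closed.pos_body_true a h1.1 h2, ?_⟩
    rintro r hr rfl b hb
    exact absurd (h.closed.pos_body_exists _ _ (h.facts.pbl r hr b hb)) h2
  pbl_inbetween x y z r h1 h2 h3 h4 h5 :=
    ⟨h.closed.pbl_inbetween x y z r h1.1 h2.1 h3.1 h4 h5, trivial⟩
  pbl_notlast x y r h1 h2 h3 := ⟨h.closed.pbl_notlast x y r h1.1 h2.1 h3, trivial⟩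
  pbl_notfirst x y r h1 h2 h3 := ⟨h.closed.pbl_notfirst x y r h1.1 h2.1 h3, trivial⟩
  upto_first x a h1 h2 h3 := by
    refine ⟨h.closed.upto_first x a h1.1 h2.1 h3, ?_⟩
    rintro r hr rfl b hb hbx
    rcases hbx.eq_or_lt with heq | hlt
    · exact h2.2 b heq
    · exact absurd (h.closed.pbl_notfirst _ _ _ h1.1 (h.facts.pbl r hr b hb) hlt) h3
  upto_next x y a h1 h2 h3 h4 h5 := by
    refine ⟨h.closed.upto_next x y a h1.1 h2.1 h3.1 h4 h5, ?_⟩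
    rintro r hr rfl b hb hbx
    rcases hbx.eq_or_lt with heq | hlt
    · exact h3.2 b heq
    · refine h1.2 r hr rfl b hb (not_lt.1 fun hyb => h5 ?_)
      exact h.closed.pbl_inbetween _ _ _ _ (h.supported h1.1).1 h2.1 (h.facts.pbl r hr b hb)
        hyb hlt
  pos_body_true_of_upto x a h1 h2 := by
    refine ⟨h.closed.pos_body_true_of_upto x a h1.1 h2, ?_⟩
    rintro r hr rfl b hb
    refine h1.2 r hr rfl b hb (not_lt.1 fun hlt => h2 ?_)
    exact h.closed.pbl_notlast _ _ _ (h.supported h1.1).1 (h.facts.pbl r hr b hb) hlt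
  neg_body_false x y h1 h2 := ⟨h.closed.neg_body_false x y h1.1 h2.1, trivial⟩
  not_compl x y h1 h2 h3 := h.closed.not_compl x y h1.1 h2.1 h3.1
  pr_total x y h1 h2 h3 := (h.closed.pr_total x y h1.1 h2.1 h3).imp
    (fun h => ⟨h, trivial⟩) fun h => ⟨h, trivial⟩
  pr_trans x y z h1 h2 := ⟨h.closed.pr_trans x y z h1.1 h2.1, trivial⟩
  pr_irrefl x h1 := h.closed.pr_irrefl x h1.1
  lit_of_not_in_AS x y h1 h2 h3 h4 := ⟨h.closed.lit_of_not_in_AS x y h1.1 h2.1 h3 h4, trivial⟩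
  lit_of_not_defeat x y h1 h2 h3 h4 := ⟨h.closed.lit_of_not_defeat x y h1.1 h2.1 h3 h4, trivial⟩
  defeat_local x y z h1 h2 h3 := ⟨h.closed.defeat_local x y z h1.1 h2.1 h3.1, trivial⟩
  defeat_global x y h1 h2 := ⟨h.closed.defeat_global x y h1.1 h2.1, trivial⟩
  in_CP x y h1 := ⟨h.closed.in_CP x y h1.1, trivial⟩
  in_AS_of_in_CP x h1 h2 := h.closed.in_AS_of_in_CP x h1.1 h2
  in_CP_of_in_AS x h1 h2 := h.closed.in_CP_of_in_AS x h1.1 h2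

theorem ContainsFacts.restricted (hf : ContainsFacts nl nr P A) {J : Set (Literal α)} :
    ContainsFacts nl nr P (A ∩ ofSpec (Restricted nl nr P J)) where
  rule r hr := ⟨hf.rule r hr, trivial⟩
  head r hr c hc := ⟨hf.head r hr c hc, trivial⟩
  pbl r hr c hc := ⟨hf.pbl r hr c hc, trivial⟩
  nbl r hr c hc := ⟨hf.nbl r hr c hc, trivial⟩
  compl a h1 h2 := ⟨hf.compl a h1 h2, trivial⟩
  pr r s h1 h2 := ⟨hf.pr r s h1 h2, trivial⟩

/-- The `compl` facts cover only atoms both of whose literals occur in the program; this suffices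
because every projected literal is a rule head. -/
theorem SupportedModel.consistent_proj (h : SupportedModel nl nr P A) :
    Consistent (proj nl A) := by
  refine Set.eq_empty_of_subset_empty fun l hl => ?_
  have hocc : ∀ k ∈ proj nl A, k ∈ occurring P.rules := fun k hk => by
    obtain ⟨r, hr, hkr, -⟩ := h.exists_head hk
    exact ⟨r, hr, Or.inl hkr⟩
  obtain ⟨h1, h2⟩ := hl
  cases l with
  | pos a => exact h.closed.not_compl _ _ (h.facts.compl a (hocc _ h1) (hocc _ h2)) h1 h2
  | neg a => exact h.closed.not_compl _ _ (h.facts.compl a (hocc _ h2) (hocc _ h1)) h2 h1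

/-- If `A` is minimal, then its projection is an answer set. -/
theorem SupportedModel.proj_mem_propAnswerSets (h : SupportedModel nl nr P A)
    (hmin : ∀ M ⊆ A, MetaClosed A M → ContainsFacts nl nr P M → M = A) :
    proj nl A ∈ propAnswerSets P.rules := by
  refine mem_propAnswerSets_iff.2 ⟨⟨fun l hl => ?_, h.consistent_proj,
    closedUnder_glReduct_iff.2 fun r hr hd hp => ?_⟩, fun J hJ hcl => subset_antisymm hJ ?_⟩
  · obtain ⟨r, hr, hlr, -⟩ := h.exists_head hl
    exact Or.inl ⟨r, hr, Or.inl hlr⟩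
  · obtain ⟨c, hc⟩ := P.normal r hr
    have hcr : c ∈ r.head := by simp [hc]
    exact ⟨c, hcr, h.closed.in_AS _ _ (h.facts.head r hr c hcr) ((h.pos_body_true_iff hr).2 hp)
      fun hn => hd ((h.neg_body_false_iff hr).1 hn)⟩
  · intro l hl
    have := hmin _ Set.inter_subset_left (h.metaClosed_restricted hcl) h.facts.restricted
    have hl' : Has (A ∩ ofSpec (Restricted nl nr P J)) in_AS [nl l] := by
      rw [this]; exact hl
    exact hl'.2 l rfl

/-- The priorities that `A` describes. -/
def SupportedModel.prioritization (h : SupportedModel nl nr P A) : PrioritizedProgram α where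
  rules := P.rules
  finite := P.finite
  normal := P.normal
  lt r s := r ∈ P.rules ∧ s ∈ P.rules ∧ Has A pr [nr r, nr s]
  lt_mem _ _ h := ⟨h.1, h.2.1⟩
  lt_irrefl _ hr := h.closed.pr_irrefl _ hr.2.2
  lt_trans _ _ _ h1 h2 := ⟨h1.1, h2.2.1, h.closed.pr_trans _ _ _ h1.2.2 h2.2.2⟩

/-- The facts supply only covering pairs, which generate the order by transitivity. Totality uses
that distinct rules have distinct names. -/
theorem SupportedModel.prioritization_mem (h : SupportedModel nl nr P A) :
    h.prioritization ∈ fullPrioritizations P := by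
  refine ⟨rfl, fun r s hrs => P.lt_le_of_covers (T := h.prioritization.lt) ?_ ?_ hrs, ?_⟩
  · exact fun r s h1 h2 => ⟨(P.lt_mem _ _ h1).1, (P.lt_mem _ _ h1).2, h.facts.pr r s h1 h2⟩
  · exact h.prioritization.lt_trans
  · intro r hr s hs hne
    exact (h.closed.pr_total _ _ (h.facts.rule r hr) (h.facts.rule s hs)
      fun he => hne (h.injOn hr hs he)).imp (fun h => ⟨hr, hs, h⟩) fun h => ⟨hs, hr, h⟩

/-- The two rules for `lit` are the two cases in which "head in `X` and defeated by `X`" fails;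
`defeat_local` expresses the recursive condition. -/
theorem SupportedModel.isApplied (h : SupportedModel nl nr P A) :
    IsApplied h.prioritization (proj nl A) fun r => ∃ x, Has A lit [x, nr r] := by
  intro r (hr : r ∈ P.rules)
  have hloc : Has A defeat_local [nr r] ↔ ∃ s, (∃ x, Has A lit [x, nr s]) ∧
      h.prioritization.lt s r ∧ ∃ b ∈ r.neg, b ∈ s.head := by
    constructor
    · intro hd
      obtain ⟨x, z, h1, h2, h3⟩ := h.supported hd
      obtain ⟨b, hb, rfl⟩ := (h.nbl_iff hr).1 h1
      obtain ⟨⟨s, hs, rfl⟩, -⟩ := h.supported h3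
      exact ⟨s, ⟨_, h2⟩, ⟨hs, hr, h3⟩, b, hb, (h.head_iff hs).1 (h.supported h2).1⟩
    · rintro ⟨s, ⟨x, hx⟩, ⟨hs, -, hlt⟩, b, hb, hbs⟩
      -- The argument of `lit` names a head literal of the rule, and there is only one, so it must
      -- name `b`.
      obtain ⟨t, ht, c, hc, rfl, hts⟩ := h.supported (h.supported hx).1
      obtain rfl := h.injOn ht hs hts
      obtain ⟨d, hd⟩ := P.normal t hs
      simp only [hd, List.mem_singleton] at hbs hc
      rw [hc, ← hbs] at hx
      exact h.closed.defeat_local _ _ _ (h.facts.nbl r hr b hb) hx hlt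
  rw [← hloc, ← h.pos_body_true_iff hr, ← h.defeat_global_iff hr]
  obtain ⟨d, hd⟩ := P.normal r hr
  have hdr : d ∈ r.head := by simp [hd]
  have hX : (∀ h ∈ r.head, h ∈ proj nl A) ↔ Has A in_AS [nl d] := by
    simp only [hd, List.mem_singleton, forall_eq]; rfl
  rw [hX, not_and_or]
  constructor
  · rintro ⟨x, hx⟩
    obtain ⟨h1, h2, h3, h4⟩ := h.supported hx
    obtain ⟨t, ht, c, hc, rfl, htr⟩ := h.supported h1
    obtain rfl := h.injOn ht hr htr
    simp only [hd, List.mem_singleton] at hc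
    subst hc
    exact ⟨h2, h3, h4⟩
  · rintro ⟨h2, h3, h4 | h4⟩
    · exact ⟨_, h.closed.lit_of_not_in_AS _ _ (h.facts.head r hr d hdr) h2 h3 h4⟩
    · exact ⟨_, h.closed.lit_of_not_defeat _ _ (h.facts.head r hr d hdr) h2 h3 h4⟩

/-- The projections of the answer sets of the meta-program are B-preferred answer sets. -/
theorem proj_mem_bpas [Nonempty C] (hnl : Function.Injective nl) (hnr : Set.InjOn nr P.rules)
    (hA : A ∈ answerSets (PIB ∪ factsOf nl nr P)) : proj nl A ∈ bpas P := by
  obtain ⟨⟨-, -, hcl, hf⟩, hmin⟩ := mem_answerSets_iff.1 hA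
  have hsup := hmin _ Set.inter_subset_left (metaClosed_supported hcl)
    (containsFacts_supported (nl := nl) (nr := nr) (P := P) hf)
  have h : SupportedModel nl nr P A :=
    ⟨hcl, hf, fun {p cs} hp => by
      have : Has (A ∩ ofSpec (Supported nl nr P A)) p cs := by rw [hsup]; exact hp
      exact this.2, hnl, hnr⟩
  refine mem_bpas_iff.2 ⟨h.prioritization, h.prioritization_mem, ?_⟩
  refine (isBPreferredFull_iff h.prioritization_mem.2.2 h.isApplied).2
    ⟨h.proj_mem_propAnswerSets hmin, subset_antisymm ?_ fun l hl => ?_⟩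
  · rintro l ⟨r, hr, ⟨x, hx⟩, hlr⟩
    obtain ⟨t, ht, c, hc, rfl, htr⟩ := h.supported (h.supported hx).1
    obtain rfl := h.injOn ht hr htr
    obtain ⟨d, hd⟩ := P.normal t hr
    simp only [hd, List.mem_singleton] at hlr hc
    rw [hc, ← hlr] at hx
    by_contra hn
    exact h.closed.in_AS_of_in_CP _ (h.closed.in_CP _ _ hx) hn
  · have hcp : Has A in_CP [nl l] := by
      by_contra hn
      exact h.closed.in_CP_of_in_AS _ hl hn
    obtain ⟨y, hy⟩ := h.supported hcp
    obtain ⟨r, hr, c, hc, hcl, rfl⟩ := h.supported (h.supported hy).1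
    exact ⟨r, hr, ⟨_, hy⟩, h.injective hcl ▸ hc⟩

end Soundness

/-! ### The Herbrand universe and base of the meta-program -/

section Signature

variable {C : Type*}

open MetaPred

theorem mem_herbrandUniverse_of_mem_constants [Nonempty C] {Pr V : Type*}
    {R : Set (FORule Pr V C)} {c : C}
    (hc : c ∈ constants R) : c ∈ herbrandUniverse R := by
  unfold herbrandUniverse
  rwa [if_neg (fun h => by rw [h] at hc; exact hc)]

/-- The arities of the predicates of the meta-interpreter. -/
def arity : MetaPred → ℕ
  | rule | in_AS | in_CP | pos_body_exists | pos_body_true | neg_body_false | defeat_global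
  | defeat_local => 1
  | head | pbl | nbl | MetaPred.compl | pr | pbl_notlast | pbl_notfirst | pos_body_true_upto
  | lit => 2
  | pbl_inbetween => 3

/-- The rules of the meta-interpreter mention every predicate with its arity, so the Herbrand base
has all of them even if `P` yields no fact for some. -/
theorem exists_rule_of_arity (p : MetaPred) :
    ∃ r ∈ (PIB : Set (FORule MetaPred MetaVar C)), ∃ k ∈ r.lits,
      k.atom.pred = p ∧ k.atom.args.length = arity p := by
  simp only [PIB, PIa, Set.mem_union, Set.mem_ofPred_eq, List.mem_cons, List.not_mem_nil, or_false,
    or_and_right, exists_or, exists_eq_left, Rule.lits]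
  cases p <;> simp [vAtom, Literal.atom, arity]

section

variable {α : Type*} [Nonempty C] {nl : Literal α → C} {nr : Rule (Literal α) → C}
  {P : PrioritizedProgram α}

theorem mem_herbrandUniverse_of_fact {p : MetaPred} {cs : List C}
    (hp : fact p cs ∈ factsOf nl nr P) {c : C} (hc : c ∈ cs) :
    c ∈ herbrandUniverse (PIB ∪ factsOf nl nr P : Set (FORule MetaPred MetaVar C)) :=
  mem_herbrandUniverse_of_mem_constants ⟨fact p cs, Or.inr hp,
    Or.inl ⟨_, Or.inl (List.mem_singleton_self _), List.mem_map_of_mem hc⟩⟩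

theorem nr_mem_herbrandUniverse {r : Rule (Literal α)} (hr : r ∈ P.rules) :
    nr r ∈ herbrandUniverse (PIB ∪ factsOf nl nr P : Set (FORule MetaPred MetaVar C)) :=
  mem_herbrandUniverse_of_fact (.inl (.inl (.inl (.inl (.inl ⟨r, hr, rfl⟩)))))
    (List.mem_singleton_self _)

theorem nl_mem_herbrandUniverse {r : Rule (Literal α)} (hr : r ∈ P.rules) {l : Literal α}
    (hl : l ∈ r.lits) :
    nl l ∈ herbrandUniverse (PIB ∪ factsOf nl nr P : Set (FORule MetaPred MetaVar C)) := by
  rcases hl with hl | hl | hl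
  · exact mem_herbrandUniverse_of_fact
      (.inl (.inl (.inl (.inl (.inr ⟨r, hr, l, hl, rfl⟩))))) (List.mem_cons_self ..)
  · exact mem_herbrandUniverse_of_fact
      (.inl (.inl (.inl (.inr ⟨r, hr, l, hl, rfl⟩)))) (List.mem_cons_self ..)
  · exact mem_herbrandUniverse_of_fact
      (.inl (.inl (.inr ⟨r, hr, l, hl, rfl⟩))) (List.mem_cons_self ..)

end

end Signature

/-! ### Completeness: the canonical answer set -/

section Completeness

variable {α C : Type*} [LinearOrder C] {nl : Literal α → C} {nr : Rule (Literal α) → C}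
  {P Q : PrioritizedProgram α} {X : Set (Literal α)} {Ap : Rule (Literal α) → Prop}

open MetaPred

/-- The atoms of the answer set of the meta-program for the B-preferred answer set `X` with the
full prioritization `Q`, in which the rules in `Ap` are applied. -/
def Canonical (nl : Literal α → C) (nr : Rule (Literal α) → C) (Q : PrioritizedProgram α)
    (X : Set (Literal α)) (Ap : Rule (Literal α) → Prop) : MetaPred → List C → Prop
  | rule, [a] => ∃ r ∈ Q.rules, nr r = a
  | head, [x, a] => ∃ r ∈ Q.rules, nr r = a ∧ ∃ c ∈ r.head, nl c = x
  | pbl, [x, a] => ∃ r ∈ Q.rules, nr r = a ∧ ∃ c ∈ r.pos, nl c = x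
  | nbl, [x, a] => ∃ r ∈ Q.rules, nr r = a ∧ ∃ c ∈ r.neg, nl c = x
  | MetaPred.compl, [x, y] => ∃ a, Literal.pos a ∈ occurring Q.rules ∧
      Literal.neg a ∈ occurring Q.rules ∧ nl (.pos a) = x ∧ nl (.neg a) = y
  | pr, [x, y] => ∃ r s, Q.lt r s ∧ nr r = x ∧ nr s = y
  | in_AS, [x] => ∃ l ∈ X, nl l = x
  | in_CP, [x] => ∃ l ∈ X, nl l = x
  | pos_body_exists, [a] => ∃ r ∈ Q.rules, nr r = a ∧ ∃ b, b ∈ r.pos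
  | pos_body_true, [a] => ∃ r ∈ Q.rules, nr r = a ∧ ∀ b ∈ r.pos, b ∈ X
  | pbl_inbetween, [x, y, a] => ∃ r ∈ Q.rules, nr r = a ∧ (∃ b ∈ r.pos, nl b = x) ∧
      (∃ b ∈ r.pos, nl b = y) ∧ ∃ b ∈ r.pos, x < nl b ∧ nl b < y
  | pbl_notlast, [x, a] => ∃ r ∈ Q.rules, nr r = a ∧ (∃ b ∈ r.pos, nl b = x) ∧
      ∃ b ∈ r.pos, x < nl b
  | pbl_notfirst, [x, a] => ∃ r ∈ Q.rules, nr r = a ∧ (∃ b ∈ r.pos, nl b = x) ∧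
      ∃ b ∈ r.pos, nl b < x
  | pos_body_true_upto, [a, x] => ∃ r ∈ Q.rules, nr r = a ∧ (∃ b ∈ r.pos, nl b = x) ∧
      ∀ b ∈ r.pos, nl b ≤ x → b ∈ X
  | neg_body_false, [a] => ∃ r ∈ Q.rules, nr r = a ∧ Defeats X r
  | defeat_global, [a] => ∃ r ∈ Q.rules, nr r = a ∧ Defeats X r
  | defeat_local, [a] => ∃ r ∈ Q.rules, nr r = a ∧ ∃ s, Ap s ∧ Q.lt s r ∧ ∃ b ∈ r.neg, b ∈ s.head
  | lit, [x, a] => ∃ r ∈ Q.rules, nr r = a ∧ Ap r ∧ ∃ c ∈ r.head, nl c = x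
  | _, _ => False

/-- The data of a B-preferred answer set of a totally ordered program. -/
structure PreferredData (nl : Literal α → C) (nr : Rule (Literal α) → C) (Q : PrioritizedProgram α)
    (X : Set (Literal α)) (Ap : Rule (Literal α) → Prop) : Prop where
  injective : Function.Injective nl
  injOn : Set.InjOn nr Q.rules
  total : Q.IsTotal
  answer : X ∈ propAnswerSets Q.rules
  applied : IsApplied Q X Ap
  heads : {h | ∃ r ∈ Q.rules, Ap r ∧ h ∈ r.head} = X

/-- Injectivity of the names identifies the rules and literals described by different body atoms.
The `lit` clauses then reduce to the recursion for applied rules, and `in_CP` to the equality of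
their heads with `X`. -/
theorem PreferredData.metaClosed (h : PreferredData nl nr Q X Ap) :
    MetaClosed (ofSpec (Canonical nl nr Q X Ap)) (ofSpec (Canonical nl nr Q X Ap)) where
  in_AS := by
    rintro _ _ ⟨r, hr, rfl, c, hc, rfl⟩ ⟨s, hs, hsr, hp⟩ hn
    obtain rfl := h.injOn hs hr hsr
    exact ⟨c, Q.head_mem_of_fires h.answer hs ⟨hp, fun hd => hn ⟨s, hs, rfl, hd⟩⟩ hc, rfl⟩
  pos_body_exists := by
    rintro _ _ ⟨r, hr, rfl, c, hc, rfl⟩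
    exact ⟨r, hr, rfl, c, hc⟩
  pos_body_true := by
    rintro _ ⟨r, hr, rfl⟩ hn
    exact ⟨r, hr, rfl, fun b hb => absurd ⟨r, hr, rfl, b, hb⟩ hn⟩
  pbl_inbetween := by
    rintro _ _ _ _ ⟨r, hr, rfl, x, hx, rfl⟩ ⟨s, hs, hsr, y, hy, rfl⟩ ⟨t, ht, htr, z, hz, rfl⟩ h1 h2
    obtain rfl := h.injOn hs hr hsr
    obtain rfl := h.injOn ht hr htr
    exact ⟨t, hr, rfl, ⟨x, hx, rfl⟩, ⟨y, hy, rfl⟩, z, hz, h1, h2⟩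
  pbl_notlast := by
    rintro _ _ _ ⟨r, hr, rfl, x, hx, rfl⟩ ⟨s, hs, hsr, y, hy, rfl⟩ h1
    obtain rfl := h.injOn hs hr hsr
    exact ⟨s, hr, rfl, ⟨x, hx, rfl⟩, y, hy, h1⟩
  pbl_notfirst := by
    rintro _ _ _ ⟨r, hr, rfl, x, hx, rfl⟩ ⟨s, hs, hsr, y, hy, rfl⟩ h1
    obtain rfl := h.injOn hs hr hsr
    exact ⟨s, hr, rfl, ⟨x, hx, rfl⟩, y, hy, h1⟩
  upto_first := by
    rintro _ _ ⟨r, hr, rfl, x, hx, rfl⟩ ⟨l, hl, hlx⟩ hn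
    obtain rfl := h.injective hlx
    refine ⟨r, hr, rfl, ⟨l, hx, rfl⟩, fun b hb hbl => ?_⟩
    rcases hbl.eq_or_lt with heq | hlt
    · rwa [h.injective heq]
    · exact absurd ⟨r, hr, rfl, ⟨l, hx, rfl⟩, b, hb, hlt⟩ hn
  upto_next := by
    rintro _ _ _ ⟨r, hr, rfl, ⟨y, hy, rfl⟩, hup⟩ ⟨s, hs, hsr, x, hx, rfl⟩ ⟨l, hl, hlx⟩ hyx hn
    obtain rfl := h.injOn hs hr hsr
    obtain rfl := h.injective hlx
    refine ⟨s, hr, rfl, ⟨l, hx, rfl⟩, fun b hb hbl => ?_⟩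
    rcases hbl.eq_or_lt with heq | hlt
    · rwa [h.injective heq]
    · exact hup b hb (not_lt.1 fun hyb =>
        hn ⟨s, hr, rfl, ⟨y, hy, rfl⟩, ⟨l, hx, rfl⟩, b, hb, hyb, hlt⟩)
  pos_body_true_of_upto := by
    rintro _ _ ⟨r, hr, rfl, hx, hup⟩ hn
    exact ⟨r, hr, rfl, fun b hb => hup b hb (not_lt.1 fun hlt =>
      hn ⟨r, hr, rfl, hx, b, hb, hlt⟩)⟩
  neg_body_false := by
    rintro _ _ ⟨r, hr, rfl, x, hx, rfl⟩ ⟨l, hl, hlx⟩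
    exact ⟨r, hr, rfl, x, hx, h.injective hlx ▸ hl⟩
  not_compl := by
    rintro _ _ ⟨a, -, -, rfl, rfl⟩ ⟨l, hl, hlx⟩ ⟨k, hk, hkx⟩
    obtain rfl := h.injective hlx
    obtain rfl := h.injective hkx
    exact (mem_propAnswerSets_iff.1 h.answer).1.2.1.subset ⟨hl, hk⟩
  pr_total := by
    rintro _ _ ⟨r, hr, rfl⟩ ⟨s, hs, rfl⟩ hne
    exact (h.total r hr s hs fun he => hne (congrArg nr he)).imp
      (fun h => ⟨r, s, h, rfl, rfl⟩) fun h => ⟨s, r, h, rfl, rfl⟩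
  pr_trans := by
    rintro _ _ _ ⟨r, s, h1, rfl, rfl⟩ ⟨s', t, h2, hs, rfl⟩
    obtain rfl := h.injOn (Q.lt_mem _ _ h2).1 (Q.lt_mem _ _ h1).2 hs
    exact ⟨r, t, Q.lt_trans _ _ _ h1 h2, rfl, rfl⟩
  pr_irrefl := by
    rintro _ ⟨r, s, h1, rfl, hs⟩
    obtain rfl := h.injOn (Q.lt_mem _ _ h1).2 (Q.lt_mem _ _ h1).1 hs
    exact Q.lt_irrefl _ h1
  lit_of_not_in_AS := by
    rintro _ _ ⟨r, hr, rfl, c, hc, rfl⟩ ⟨s, hs, hsr, hp⟩ h1 h2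
    obtain rfl := h.injOn hs hr hsr
    refine ⟨s, hr, rfl, (h.applied s hr).2 ⟨hp, fun hl => h1 ⟨s, hr, rfl, hl⟩, fun hd => h2 ?_⟩,
      c, hc, rfl⟩
    exact ⟨c, hd.1 c hc, rfl⟩
  lit_of_not_defeat := by
    rintro _ _ ⟨r, hr, rfl, c, hc, rfl⟩ ⟨s, hs, hsr, hp⟩ h1 h2
    obtain rfl := h.injOn hs hr hsr
    exact ⟨s, hr, rfl, (h.applied s hr).2 ⟨hp, fun hl => h1 ⟨s, hr, rfl, hl⟩,
      fun hd => h2 ⟨s, hr, rfl, hd.2⟩⟩, c, hc, rfl⟩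
  defeat_local := by
    rintro _ _ _ ⟨r, hr, rfl, b, hb, rfl⟩ ⟨s, hs, rfl, has, c, hc, hcb⟩ ⟨s', r', hlt, hs', hr'⟩
    obtain rfl := h.injOn (Q.lt_mem _ _ hlt).1 hs hs'
    obtain rfl := h.injOn (Q.lt_mem _ _ hlt).2 hr hr'
    exact ⟨r', hr, rfl, s', has, hlt, b, hb, h.injective hcb ▸ hc⟩
  defeat_global := by
    rintro _ _ ⟨r, hr, rfl, x, hx, rfl⟩ ⟨l, hl, hlx⟩
    exact ⟨r, hr, rfl, x, hx, h.injective hlx ▸ hl⟩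
  in_CP := by
    rintro _ _ ⟨r, hr, rfl, ha, c, hc, rfl⟩
    exact ⟨c, h.heads.subset ⟨r, hr, ha, hc⟩, rfl⟩
  in_AS_of_in_CP := fun _ h1 h2 => h2 h1
  in_CP_of_in_AS := fun _ h1 h2 => h2 h1

theorem PreferredData.containsFacts (hQ : Q ∈ fullPrioritizations P) :
    ContainsFacts nl nr P (ofSpec (Canonical nl nr Q X Ap)) where
  rule r hr := ⟨r, hQ.1.symm ▸ hr, rfl⟩
  head r hr c hc := ⟨r, hQ.1.symm ▸ hr, rfl, c, hc, rfl⟩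
  pbl r hr c hc := ⟨r, hQ.1.symm ▸ hr, rfl, c, hc, rfl⟩
  nbl r hr c hc := ⟨r, hQ.1.symm ▸ hr, rfl, c, hc, rfl⟩
  compl a h1 h2 := ⟨a, hQ.1.symm ▸ h1, hQ.1.symm ▸ h2, rfl, rfl⟩
  pr r s h1 _ := ⟨r, s, hQ.2.1 r s h1, rfl, rfl⟩

theorem PreferredData.bodyOrderSound (h : PreferredData nl nr Q X Ap) :
    BodyOrderSound nl nr Q (ofSpec (Canonical nl nr Q X Ap)) where
  exists_mem := by
    rintro r hr ⟨s, hs, hsr, hb⟩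
    exact h.injOn hs hr hsr ▸ hb
  inbetween := by
    rintro r hr x y ⟨s, hs, hsr, -, -, hb⟩
    exact h.injOn hs hr hsr ▸ hb
  notlast := by
    rintro r hr x ⟨s, hs, hsr, -, hb⟩
    exact h.injOn hs hr hsr ▸ hb
  notfirst := by
    rintro r hr x ⟨s, hs, hsr, -, hb⟩
    exact h.injOn hs hr hsr ▸ hb

/-- The canonical set is minimal. -/
theorem PreferredData.canonical_subset (h : PreferredData nl nr Q X Ap)
    (hQ : Q.rules = P.rules) {M : Set (Literal (Atom MetaPred C))}
    (hMA : M ⊆ ofSpec (Canonical nl nr Q X Ap))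
    (hM : MetaClosed (ofSpec (Canonical nl nr Q X Ap)) M) (hf : ContainsFacts nl nr P M) :
    ofSpec (Canonical nl nr Q X Ap) ⊆ M := by
  have hsound : BodyOrderSound nl nr P (ofSpec (Canonical nl nr Q X Ap)) :=
    ⟨fun r hr => h.bodyOrderSound.1 r (hQ ▸ hr), fun r hr => h.bodyOrderSound.2 r (hQ ▸ hr),
      fun r hr => h.bodyOrderSound.3 r (hQ ▸ hr), fun r hr => h.bodyOrderSound.4 r (hQ ▸ hr)⟩
  have hfrule : ∀ r ∈ Q.rules, Has M rule [nr r] := fun r hr => hf.rule r (hQ ▸ hr)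
  have hfhead : ∀ r ∈ Q.rules, ∀ c ∈ r.head, Has M head [nl c, nr r] :=
    fun r hr => hf.head r (hQ ▸ hr)
  have hfpbl : ∀ r ∈ Q.rules, ∀ c ∈ r.pos, Has M pbl [nl c, nr r] :=
    fun r hr => hf.pbl r (hQ ▸ hr)
  have hfnbl : ∀ r ∈ Q.rules, ∀ c ∈ r.neg, Has M nbl [nl c, nr r] :=
    fun r hr => hf.nbl r (hQ ▸ hr)
  have hnotdef : ∀ r ∈ Q.rules, ¬ Defeats X r →
      ¬ Has (ofSpec (Canonical nl nr Q X Ap)) neg_body_false [nr r] := by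
    rintro r hr hd ⟨s, hs, hsr, hds⟩
    exact hd (h.injOn hs hr hsr ▸ hds)
  -- `Canonical` specifies `defeat_global` and `neg_body_false` identically, so one proof serves
  -- both.
  have hnotglob : ∀ r ∈ Q.rules, ¬ Defeats X r →
      ¬ Has (ofSpec (Canonical nl nr Q X Ap)) defeat_global [nr r] := hnotdef
  -- The literals of `X` that `M` derives are closed under the reduct of `Q.rules`, hence exhaust
  -- `X` by its minimality.
  have hAS : ∀ l ∈ X, Has M in_AS [nl l] := by
    have := (mem_propAnswerSets_iff.1 h.answer).2 {l ∈ X | Has M in_AS [nl l]} (fun _ h => h.1)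
      (closedUnder_glReduct_iff.2 fun r hr hd hp => by
        obtain ⟨c, hc⟩ := Q.normal r hr
        have hcr : c ∈ r.head := by simp [hc]
        refine ⟨c, hcr, Q.head_mem_of_fires h.answer hr ⟨fun b hb => (hp b hb).1, hd⟩ hcr, ?_⟩
        exact hM.in_AS _ _ (hfhead r hr c hcr)
          (hM.has_pos_body_true hf hsound (hQ ▸ hr) fun b hb => (hp b hb).2) (hnotdef r hr hd))
    intro l hl
    rw [← this] at hl
    exact hl.2
  have hpbt : ∀ r ∈ Q.rules, (∀ b ∈ r.pos, b ∈ X) → Has M pos_body_true [nr r] :=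
    fun r hr hp => hM.has_pos_body_true hf hsound (hQ ▸ hr) fun b hb => hAS b (hp b hb)
  have hpr : ∀ r s, Q.lt r s → Has M pr [nr r, nr s] := fun r s hlt => by
    obtain ⟨hr, hs⟩ := Q.lt_mem _ _ hlt
    -- `M` must contain one disjunct; the reverse pair would lie in the canonical set and contradict
    -- asymmetry of `Q.lt`.
    rcases hM.pr_total _ _ (hfrule r hr) (hfrule s hs) (fun he => by
      obtain rfl := h.injOn hr hs he
      exact Q.lt_irrefl _ hlt) with h1 | h1
    · exact h1
    · obtain ⟨s', r', hlt', hs', hr'⟩ := hMA h1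
      obtain rfl := h.injOn (Q.lt_mem _ _ hlt').1 hs hs'
      obtain rfl := h.injOn (Q.lt_mem _ _ hlt').2 hr hr'
      exact absurd (Q.lt_trans _ _ _ hlt hlt') (Q.lt_irrefl _)
  have hlit : ∀ r ∈ Q.rules, Ap r → ∀ c ∈ r.head, Has M lit [nl c, nr r] := by
    intro r hr har c hc
    obtain ⟨hp, hloc, hgl⟩ := (h.applied r hr).1 har
    have hloc' : ¬ Has (ofSpec (Canonical nl nr Q X Ap)) defeat_local [nr r] := by
      rintro ⟨s, hs, hsr, hl⟩
      exact hloc (h.injOn hs hr hsr ▸ hl)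
    -- If `X` defeats an applied rule, its head is not in `X` and the first rule for `lit` derives
    -- it; otherwise the second does.
    by_cases hd : Defeats X r
    · refine hM.lit_of_not_in_AS _ _ (hfhead r hr c hc) (hpbt r hr hp) hloc' ?_
      rintro ⟨l, hl, hlc⟩
      obtain rfl := h.injective hlc
      obtain ⟨d, hd'⟩ := Q.normal r hr
      simp only [hd', List.mem_singleton, forall_eq] at hc hgl
      exact hgl ⟨hc ▸ hl, hd⟩
    · exact hM.lit_of_not_defeat _ _ (hfhead r hr c hc) (hpbt r hr hp) hloc' (hnotglob r hr hd)
  rintro (⟨p, cs⟩ | _) hx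
  swap
  · exact hx.elim
  change Has M p cs
  change Canonical nl nr Q X Ap p cs at hx
  unfold Canonical at hx
  split at hx
  · obtain ⟨r, hr, rfl⟩ := hx
    exact hfrule r hr
  · obtain ⟨r, hr, rfl, c, hc, rfl⟩ := hx
    exact hfhead r hr c hc
  · obtain ⟨r, hr, rfl, c, hc, rfl⟩ := hx
    exact hfpbl r hr c hc
  · obtain ⟨r, hr, rfl, c, hc, rfl⟩ := hx
    exact hfnbl r hr c hc
  · obtain ⟨a, h1, h2, rfl, rfl⟩ := hx
    exact hf.compl a (hQ ▸ h1) (hQ ▸ h2)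
  · obtain ⟨r, s, hlt, rfl, rfl⟩ := hx
    exact hpr r s hlt
  · obtain ⟨l, hl, rfl⟩ := hx
    exact hAS l hl
  · obtain ⟨l, hl, rfl⟩ := hx
    obtain ⟨r, hr, ha, hc⟩ := h.heads.ge hl
    exact hM.in_CP _ _ (hlit r hr ha l hc)
  · obtain ⟨r, hr, rfl, b, hb⟩ := hx
    exact hM.pos_body_exists _ _ (hfpbl r hr b hb)
  · obtain ⟨r, hr, rfl, hp⟩ := hx
    exact hpbt r hr hp
  · obtain ⟨r, hr, rfl, ⟨x, hx, rfl⟩, ⟨y, hy, rfl⟩, z, hz, h1, h2⟩ := hx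
    exact hM.pbl_inbetween _ _ _ _ (hfpbl r hr x hx) (hfpbl r hr y hy) (hfpbl r hr z hz) h1 h2
  · obtain ⟨r, hr, rfl, ⟨x, hx, rfl⟩, z, hz, h1⟩ := hx
    exact hM.pbl_notlast _ _ _ (hfpbl r hr x hx) (hfpbl r hr z hz) h1
  · obtain ⟨r, hr, rfl, ⟨x, hx, rfl⟩, z, hz, h1⟩ := hx
    exact hM.pbl_notfirst _ _ _ (hfpbl r hr x hx) (hfpbl r hr z hz) h1
  · obtain ⟨r, hr, rfl, ⟨x, hx, rfl⟩, hup⟩ := hx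
    exact hM.has_pos_body_true_upto hf hsound (hQ ▸ hr) hx fun b hb hbx => hAS b (hup b hb hbx)
  · obtain ⟨r, hr, rfl, b, hb, hbX⟩ := hx
    exact hM.neg_body_false _ _ (hfnbl r hr b hb) (hAS b hbX)
  · obtain ⟨r, hr, rfl, b, hb, hbX⟩ := hx
    exact hM.defeat_global _ _ (hfnbl r hr b hb) (hAS b hbX)
  · obtain ⟨r, hr, rfl, s, has, hlt, b, hb, hbs⟩ := hx
    exact hM.defeat_local _ _ _ (hfnbl r hr b hb) (hlit s (Q.lt_mem _ _ hlt).1 has b hbs)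
      (hpr s r hlt)
  · obtain ⟨r, hr, rfl, ha, c, hc, rfl⟩ := hx
    exact hlit r hr ha c hc
  · exact hx.elim

/-- Every constant involved names a rule or an occurring literal of `P` and so appears in a fact;
literals of `X` occur as heads of applied rules. -/
theorem PreferredData.canonical_subset_herbrandBase [Nonempty C] (h : PreferredData nl nr Q X Ap)
    (hQ : Q.rules = P.rules) :
    ofSpec (Canonical nl nr Q X Ap) ⊆
      herbrandBase (PIB ∪ factsOf nl nr P : Set (FORule MetaPred MetaVar C)) := by
  set U := herbrandUniverse (PIB ∪ factsOf nl nr P : Set (FORule MetaPred MetaVar C)) with hU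
  have hr' : ∀ r ∈ Q.rules, nr r ∈ U := fun r hr => nr_mem_herbrandUniverse (hQ ▸ hr)
  have hlits : ∀ r ∈ Q.rules, ∀ l ∈ r.lits, nl l ∈ U :=
    fun r hr l hl => nl_mem_herbrandUniverse (hQ ▸ hr) hl
  have hX : ∀ l ∈ X, nl l ∈ U := fun l hl => by
    obtain ⟨r, hr, -, hc⟩ := h.heads.ge hl
    exact hlits r hr l (Or.inl hc)
  rintro (⟨p, cs⟩ | _) hx
  swap
  · exact hx.elim
  change Canonical nl nr Q X Ap p cs at hx
  suffices cs.length = arity p ∧ ∀ c ∈ cs, c ∈ U by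
    obtain ⟨r, hr, k, hk, h1, h2⟩ := exists_rule_of_arity (C := C) p
    exact ⟨⟨r, Or.inl hr, k, hk, h1.symm, this.1.trans h2.symm⟩, this.2⟩
  unfold Canonical at hx
  split at hx
  all_goals try simp only [arity, List.length_cons, List.length_nil, List.mem_cons,
    List.not_mem_nil, or_false, forall_eq_or_imp, forall_eq, true_and, zero_add, Nat.reduceAdd]
  · obtain ⟨r, hr, rfl⟩ := hx
    exact hr' r hr
  · obtain ⟨r, hr, rfl, c, hc, rfl⟩ := hx
    exact ⟨hlits r hr c (.inl hc), hr' r hr⟩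
  · obtain ⟨r, hr, rfl, c, hc, rfl⟩ := hx
    exact ⟨hlits r hr c (.inr (.inl hc)), hr' r hr⟩
  · obtain ⟨r, hr, rfl, c, hc, rfl⟩ := hx
    exact ⟨hlits r hr c (.inr (.inr hc)), hr' r hr⟩
  · obtain ⟨a, ⟨r, hr, h1⟩, ⟨s, hs, h2⟩, rfl, rfl⟩ := hx
    exact ⟨hlits r hr _ h1, hlits s hs _ h2⟩
  · obtain ⟨r, s, hlt, rfl, rfl⟩ := hx
    exact ⟨hr' r (Q.lt_mem _ _ hlt).1, hr' s (Q.lt_mem _ _ hlt).2⟩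
  · obtain ⟨l, hl, rfl⟩ := hx
    exact hX l hl
  · obtain ⟨l, hl, rfl⟩ := hx
    exact hX l hl
  · obtain ⟨r, hr, rfl, -⟩ := hx
    exact hr' r hr
  · obtain ⟨r, hr, rfl, -⟩ := hx
    exact hr' r hr
  · obtain ⟨r, hr, rfl, ⟨x, hx, rfl⟩, ⟨y, hy, rfl⟩, -⟩ := hx
    exact ⟨hlits r hr x (.inr (.inl hx)), hlits r hr y (.inr (.inl hy)), hr' r hr⟩
  · obtain ⟨r, hr, rfl, ⟨x, hx, rfl⟩, -⟩ := hx
    exact ⟨hlits r hr x (.inr (.inl hx)), hr' r hr⟩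
  · obtain ⟨r, hr, rfl, ⟨x, hx, rfl⟩, -⟩ := hx
    exact ⟨hlits r hr x (.inr (.inl hx)), hr' r hr⟩
  · obtain ⟨r, hr, rfl, ⟨x, hx, rfl⟩, -⟩ := hx
    exact ⟨hr' r hr, hlits r hr x (.inr (.inl hx))⟩
  · obtain ⟨r, hr, rfl, -⟩ := hx
    exact hr' r hr
  · obtain ⟨r, hr, rfl, -⟩ := hx
    exact hr' r hr
  · obtain ⟨r, hr, rfl, -⟩ := hx
    exact hr' r hr
  · obtain ⟨r, hr, rfl, -, c, hc, rfl⟩ := hx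
    exact ⟨hlits r hr c (.inl hc), hr' r hr⟩
  · exact hx.elim

/-- Each B-preferred answer set is the projection of an answer set of the meta-program. -/
theorem exists_proj_eq [Nonempty C] (hnl : Function.Injective nl) (hnr : Set.InjOn nr P.rules)
    (hX : X ∈ bpas P) : ∃ A ∈ answerSets (PIB ∪ factsOf nl nr P), proj nl A = X := by
  obtain ⟨Q, hQ, hX⟩ := mem_bpas_iff.1 hX
  obtain ⟨Ap, hAp⟩ := exists_isApplied Q X
  obtain ⟨hans, hheads⟩ := (isBPreferredFull_iff hQ.2.2 hAp).1 hX
  have h : PreferredData nl nr Q X Ap :=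
    ⟨hnl, hQ.1.symm ▸ hnr, hQ.2.2, hans, hAp, hheads⟩
  refine ⟨ofSpec (Canonical nl nr Q X Ap), mem_answerSets_iff.2
    ⟨⟨h.canonical_subset_herbrandBase hQ.1, consistent_ofSpec _, h.metaClosed,
      PreferredData.containsFacts hQ⟩,
    fun M hMA hM hf => subset_antisymm hMA (h.canonical_subset hQ.1 hMA hM hf)⟩, ?_⟩
  ext l
  constructor
  · rintro ⟨k, hk, hkl⟩
    exact hnl hkl ▸ hk
  · exact fun hl => ⟨l, hl, rfl⟩

end Completeness

end ASP

theorem theorem2 {α C : Type*} [LinearOrder C] [Nonempty C]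
    (P : ASP.PrioritizedProgram α)
    (nl : ASP.Literal α → C) (hnl : Function.Injective nl)
    (nr : ASP.Rule (ASP.Literal α) → C) (hnr : Set.InjOn nr P.rules) :
    (∀ A ∈ ASP.answerSets (ASP.PIB ∪ ASP.factsOf nl nr P), ASP.proj nl A ∈ ASP.bpas P) ∧
    (∀ A ∈ ASP.bpas P,
      ∃ A' ∈ ASP.answerSets (ASP.PIB ∪ ASP.factsOf nl nr P), ASP.proj nl A' = A) :=
  ⟨fun _ hA => ASP.proj_mem_bpas hnl hnr hA, fun _ hA => ASP.exists_proj_eq hnl hnr hA⟩
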